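/- For an integer $m\ge 2$ let $A085680(m)$ be the maximum size of a binary code of length $m$ and constant weight $2$ that corrects a single adjacent transposition, that is, of a set $C$ of vectors in $\mathbb{F}_2^m$, each with exactly two entries equal to $1$, such that the sets $B(u)$, $u\in C$, are pairwise disjoint, where $B(u)$ consists of $u$ and of all vectors obtained from $u$ by swapping the entries in one pair of consecutive positions. For $n\ge 1$ put $$a(n)=\begin{cases}\frac{1}{10}(n^2+n+20) & \text{if } n\equiv 0 \text{ or } 4 \pmod 5,\\ \frac{1}{10}(n^2+n+18) & \text{if } n\equiv 1 \text{ or } 3 \pmod 5,\\ \frac{1}{10}(n^2+n+14) & \text{if } n\equiv 2 \pmod 5.\end{cases}$$ Then $A085680(n+1)=a(n)$ for every integer $n\ge 6$. Moreover, for every integer $n\ge 1$, $A085680(n+1)$ equals the packing number of the $2$-token graph $F_2(P_{n+1})$ of the path $P_{n+1}$ on $n+1$ vertices, and $F_2(P_{n+1})$ is isomorphic to $\Gamma_{n+1}$ and to $T(n)$. Here the packing number of a finite graph is the maximum size of a set of vertices any two distinct members of which are at distance at least $3$; $F_2(G)$ has as vertices the $2$-subsets of $V(G)$, two of them being adjacent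 when their symmetric difference is an edge of $G$; $\Gamma_m$ has as vertices the vectors of weight $2$ in $\mathbb{F}_2^m$, two distinct ones being adjacent when one arises from the other by swapping two consecutive entries; and $T(n)$ is the subgraph of the integer grid $\mathbb{Z}^2$ (with $(i,j)$ and $(i',j')$ adjacent when $|i-i'|+|j-j'|=1$) induced by the pairs $(i,j)$ with $1\le i\le j\le n$. -/

import Mathlib

/-- The closed error ball of a binary vector `u` of length `n` for the error "at most one adjacent
transposition": all vectors obtained from `u` by swapping the bits in at most one pair of
consecutive positions. -/
def transpositionBall {n : ℕ} (u : Fin n → ZMod 2) : Set (Fin n → ZMod 2) :=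
  {v | v = u ∨ ∃ i j : Fin n, (i : ℕ) + 1 = (j : ℕ) ∧ v = u ∘ Equiv.swap i j}

/-- A binary code corrects a single adjacent transposition if the error balls of distinct
codewords are disjoint. -/
def CorrectsTransposition {n : ℕ} (C : Set (Fin n → ZMod 2)) : Prop :=
  ∀ u ∈ C, ∀ v ∈ C, u ≠ v → transpositionBall u ∩ transpositionBall v = ∅

/-- The maximum size of a binary code of length `n` and constant weight `2` that corrects a
single adjacent transposition (the set of sizes is nonempty and bounded, as there are finitely
many binary vectors of length `n`). -/
noncomputable def A085680 (n : ℕ) : ℕ :=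
  sSup {m : ℕ | ∃ C : Finset (Fin n → ZMod 2),
    (∀ u ∈ C, hammingNorm u = 2) ∧
    CorrectsTransposition (C : Set (Fin n → ZMod 2)) ∧ C.card = m}

/-- A packing set of `G`: distinct vertices of `S` are at distance at least `3` in `G`
(vertices in different components are at distance `⊤`). -/
def IsPackingSet {V : Type*} (G : SimpleGraph V) (S : Set V) : Prop :=
  ∀ u ∈ S, ∀ v ∈ S, u ≠ v → 3 ≤ G.edist u v

/-- The packing number of a finite graph: the maximum cardinality of a packing set. -/
noncomputable def packingNumber {V : Type*} [Finite V] (G : SimpleGraph V) : ℕ :=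
  sSup {m : ℕ | ∃ S : Finset V, IsPackingSet G (S : Set V) ∧ S.card = m}

/-- Sloane's graph: the vertices are the binary vectors of length `n` and weight `2`, and two
distinct vertices are adjacent when one is obtained from the other by transposing a pair of
adjacent bits. -/
def sloaneGraph (n : ℕ) : SimpleGraph {u : Fin n → ZMod 2 // hammingNorm u = 2} :=
  SimpleGraph.fromRel fun u v =>
    ∃ i j : Fin n, (i : ℕ) + 1 = (j : ℕ) ∧ v.1 = u.1 ∘ Equiv.swap i j

/-- The `k`-token graph of `G`: the vertices are the `k`-subsets of the vertex set, and two of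
them are adjacent when their symmetric difference is an edge of `G`. -/
def tokenGraph {V : Type*} [DecidableEq V] (k : ℕ) (G : SimpleGraph V) :
    SimpleGraph {A : Finset V // A.card = k} where
  Adj A B := ∃ x y : V, G.Adj x y ∧ symmDiff A.1 B.1 = {x, y}
  symm := ⟨fun A B ⟨x, y, h, e⟩ => ⟨x, y, h, by rw [symmDiff_comm]; exact e⟩⟩
  loopless := ⟨fun A ⟨x, y, _, e⟩ => by
    rw [symmDiff_self] at e
    exact absurd e.symm (Finset.insert_ne_empty x {y})⟩

/-- The infinite integer grid. -/
def integerGrid : SimpleGraph (ℤ × ℤ) where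
  Adj p q := |p.1 - q.1| + |p.2 - q.2| = 1
  symm := ⟨fun p q h => by
    rw [abs_sub_comm q.1, abs_sub_comm q.2]; exact h⟩
  loopless := ⟨fun p h => by simp at h⟩

/-- The pairs `(i, j)` with `1 ≤ i, j ≤ n` and `i - j ≤ 0`. -/
noncomputable def triangleVertices (n : ℕ) : Finset (ℤ × ℤ) :=
  (Finset.Icc (1 : ℤ) n ×ˢ Finset.Icc (1 : ℤ) n).filter fun p => p.1 - p.2 ≤ 0

/-- The subgraph of the integer grid induced by the triangle `1 ≤ i ≤ j ≤ n`. -/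
def triangleGrid (n : ℕ) : SimpleGraph (triangleVertices n : Set (ℤ × ℤ)) :=
  integerGrid.induce (triangleVertices n : Set (ℤ × ℤ))

/-- The sequence `a(n)`, given by a quadratic formula on each residue class modulo `5`. -/
def aSeq (n : ℕ) : ℚ :=
  if n % 5 = 0 ∨ n % 5 = 4 then ((n : ℚ) ^ 2 + n + 20) / 10
  else if n % 5 = 1 ∨ n % 5 = 3 then ((n : ℚ) ^ 2 + n + 18) / 10
  else ((n : ℚ) ^ 2 + n + 14) / 10

/-! A pair of path vertices a < b, numbered from 0, is the same thing as its indicator vector and as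
the cell (a + 1, b) of the triangle. Moving a token, swapping two unequal consecutive bits and
making a unit grid step correspond, and error balls are disjoint exactly when the codewords are at
distance at least 3. Everything therefore reduces to the packing number of the triangle, which for n
≥ 6 is ⌊(n² + n)/10⌋ + 2. This is a(n), because n² + n is 0, 2 or 6 modulo 10.

Upper bound (`IsTrianglePacking.card_le`). The closed neighbourhoods of codewords are disjoint. Each
has five cells, less one for every leg and less two for the hypotenuse that the codeword lies on.
Hence 5|C| = n(n + 1)/2 + savings − uncovered cells, and the task is to bound savings − uncovered by
11. Codewords on a side save cells but force holes nearby. Two explicit potentials, on a strip along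
a leg and on a strip along the diagonal, show that savings never outrun holes by more than a bounded
amount. They play the role of dual solutions of a max-plus transfer recursion along the slices i + j
= s (`surplus_step`, `surplus_le`).

The triangle is cut along slice n + 1 and its second half is reflected, so that both halves grow
from an acute corner towards the right angle at (1, n). The growth starts from an exact dynamic
program over the first 15 slices. In `sliceCard_sum_le` the two diagonal potentials cancel and the
leg potentials meet in the inequality `topValue_corner`. For n < 15 the dynamic programs of the two
halves are combined directly. The finitely many inequalities on masks are evaluated by the kernel.

Lower bound (`exists_packing`). A perfect code i + 2j ≡ c (mod 5), cut to the triangle, is within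
two codewords of the bound. Exchanging a few cells near the acute corners (1, 1) and (n, n) makes up
the difference. -/

namespace TokenPacking

/-! ### Slice masks and their transfer tables -/

/-- The `i`-th binary digit of `x`. -/
def bit (x i : ℕ) : ℕ := (x.testBit i).toNat

/-- The number of ones among the lowest `k` binary digits of `x`. -/
def popc : ℕ → ℕ → ℕ
  | 0, _ => 0
  | k + 1, x => popc k x + bit x k

/-- No two consecutive binary digits of `a` are ones. -/
def sparse (a : ℕ) : Bool := Nat.beq (a &&& (a <<< 1)) 0

/-- The masks `a`, `b` may occur on consecutive slices of a packing. -/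
def compat (a b : ℕ) : Bool := Nat.beq (b &&& (a ||| a <<< 1)) 0

/-- The masks `a`, `c` may occur on slices `s`, `s + 2` of a packing. -/
def compatTwo (a c : ℕ) : Bool := Nat.beq (c &&& (a ||| a <<< 1 ||| a <<< 2)) 0

/-- `compatTwo` when the mask `c` has been shifted by one position. -/
def compatMid (a c : ℕ) : Bool := Nat.beq (c &&& (a ||| a <<< 1 ||| a >>> 1)) 0

/-- `compat` for masks aligned at the diagonal, `e` on an even slice and `o` on an odd one. -/
def compatDiag (e o : ℕ) : Bool := Nat.beq (o &&& (e ||| e >>> 1)) 0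

/-- The masks of `h` digits without consecutive ones. -/
def masks (h : ℕ) : List ℕ := (List.range (2 ^ h)).filter sparse

/-- The largest value attached to a mask that may precede `c` by two slices. -/
def bestValue (c : ℕ) (l : List (ℕ × ℕ)) : ℕ :=
  l.foldr (fun x r => bif compatTwo x.1 c then max x.2 r else r) 0

/-- Append a slice with `h` cells to a table. -/
def nextTable (h : ℕ) (T : List (ℕ × List (ℕ × ℕ))) : List (ℕ × List (ℕ × ℕ)) :=
  (masks h).map fun c =>
    (c, (T.filter fun y => compat y.1 c).map fun y => (y.1, bestValue c y.2 + popc 8 y.1))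

/-- `sliceTable k` lists, for each mask `b` on slice `k + 1`, the masks `a` on slice `k` with an
upper bound for the number of codewords on the slices up to `k`. -/
def sliceTable : ℕ → List (ℕ × List (ℕ × ℕ))
  | 0 => [(0, [(0, 0)])]
  | k + 1 => nextTable ((k + 2) / 2) (sliceTable k)

/-- Look up a key in an association list. -/
def lookupD {α : Type} (k : ℕ) (d : α) : List (ℕ × α) → α
  | [] => d
  | (k', v) :: l => bif Nat.beq k k' then v else lookupD k d l

/-- A potential for the strip along the top side: the value attached to `b` and `a` belongs to the
masks `a`, `b` of six digits on two consecutive slices. -/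
def topTable : List (ℕ × List (ℕ × ℕ)) := [
  (0, [(0, 4), (1, 4), (2, 2), (4, 4), (5, 5), (8, 2), (9, 5), (10, 2), (16, 4), (17, 4),
    (18, 2), (20, 4), (21, 4), (32, 5), (33, 5), (34, 2), (36, 5), (37, 5), (40, 2), (41, 5),
    (42, 2)]),
  (1, [(0, 3), (2, 3), (4, 3), (8, 3), (10, 3), (16, 4), (18, 3), (20, 2), (32, 3), (34, 3),
    (36, 3), (40, 3), (42, 3)]),
  (2, [(0, 4), (4, 4), (8, 4), (16, 5), (20, 3), (32, 3), (36, 4), (40, 4)]),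
  (4, [(0, 2), (1, 4), (8, 4), (9, 4), (16, 2), (17, 3), (32, 3), (33, 5), (40, 4), (41, 4)]),
  (5, [(0, 3), (8, 5), (16, 3), (32, 4), (40, 5)]),
  (8, [(0, 4), (1, 4), (2, 4), (16, 5), (17, 3), (18, 3), (32, 3), (33, 4), (34, 4)]),
  (9, [(0, 3), (2, 5), (16, 3), (18, 4), (32, 4), (34, 5)]),
  (10, [(0, 4), (16, 4), (32, 5)]),
  (16, [(0, 4), (1, 4), (2, 2), (4, 5), (5, 4), (32, 2), (33, 5), (34, 3), (36, 4), (37, 3)]),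
  (17, [(0, 3), (2, 3), (4, 2), (32, 3), (34, 4), (36, 1)]),
  (18, [(0, 4), (4, 3), (32, 4), (36, 2)]),
  (20, [(0, 4), (1, 4), (32, 4), (33, 5)]),
  (21, [(0, 5), (32, 5)]),
  (32, [(0, 5), (1, 3), (2, 3), (4, 3), (5, 3), (8, 3), (9, 6), (10, 3)]),
  (33, [(0, 3), (2, 4), (4, 1), (8, 4), (10, 4)]),
  (34, [(0, 4), (4, 2), (8, 4)]),
  (36, [(0, 2), (1, 4), (8, 4), (9, 5)]),
  (37, [(0, 3), (8, 5)]),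
  (40, [(0, 4), (1, 4), (2, 4)]),
  (41, [(0, 3), (2, 5)]),
  (42, [(0, 4)])]

/-- The potential of the masks `a`, `b` at the top end of two consecutive slices. -/
def topValue (a b : ℕ) : ℕ := lookupD a 0 (lookupD b [] topTable)

/-- A potential for the strip along the diagonal. -/
def diagTable : List (ℕ × List (ℕ × ℤ)) := [
  (0, [(0, 1), (4, 1), (2, 1), (1, -1), (5, -1)]),
  (1, [(0, -1), (4, 0), (2, 3)]),
  (2, [(0, 1), (4, -1)]),
  (4, [(0, 1), (1, 1)]),
  (5, [(0, 1)]),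
  (8, [(0, -1), (2, -3), (1, -1)]),
  (9, [(0, -3), (2, -1)]),
  (10, [(0, -1)])]

/-- The potential of the mask `e` (four digits) on an even slice and the mask `o` (three digits) on
an adjacent odd slice, at the diagonal end. -/
def diagValue (e o : ℕ) : ℤ := lookupD o 0 (lookupD e [] diagTable)

/-- The number of codewords (with masks `a`, `b`, `c` on consecutive slices) that cover the cell
with index `i` on the middle slice. -/
def cover (a b c i : ℕ) : ℕ := bit b i + bit c i + bit (c >>> 1) i + bit a i + bit (a <<< 1) i

/-- `cover` on the slice through the corner, where the mask `c` is that of the mirrored slice. -/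
def coverMid (a b c i : ℕ) : ℕ := bit b i + bit c i + bit (c <<< 1) i + bit a i + bit (a <<< 1) i

/-- The sum of the first `k` values of `f`. -/
def sumUpTo (f : ℕ → ℕ) : ℕ → ℕ
  | 0 => 0
  | k + 1 => sumUpTo f k + f k

/-! ### Finite inequalities checked by evaluation -/

/-- This settles the upper bound for 6 ≤ n ≤ 14. The two halves share the mask on slice n + 1, and
their masks on slice n must be compatible across it. -/
theorem sliceTable_small :
    ((List.range 15).all fun n => Nat.ble n 5 ||
      (sliceTable n).all fun x => (sliceTable n).all fun x' => !(Nat.beq x.1 x'.1) ||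
        x.2.all fun y => x'.2.all fun z => !(compatMid y.1 z.1) ||
          Nat.ble (y.2 + popc 8 x.1 + z.2) ((n ^ 2 + n) / 10 + 2)) = true := by
  decide +kernel

/-- This is the base case k = 15 of `surplus_le` with everything unfolded; 56 is the number of cells
on slices up to 15. -/
theorem sliceTable_fifteen :
    ((sliceTable 15).all fun x => x.2.all fun y =>
      decide (2 * (5 * y.2 + 2 * popc 8 x.1 : ℤ) ≤
        2 * (2 * popc 8 y.1 + bit x.1 0 + bit x.1 7 + 56) +
        diagValue (x.1 >>> 4) (y.1 >>> 4) + 2 * topValue (y.1 % 64) (x.1 % 64) + 1)) = true := by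
  decide +kernel

/-- Amortised inequality along a leg: the saving of the new leg codeword, minus the holes among the
first five cells of its slice, is paid for by the change of potential. Six digits suffice because
the cell of index 4 sees digit 5 of the next slice. -/
theorem topValue_step :
    ((masks 6).all fun a => (masks 6).all fun b => !(compat a b) || (masks 6).all fun c =>
      !(compat b c && compatTwo a c) ||
        Nat.ble (topValue a b + bit b 0 + sumUpTo (cover a b c) 5) (topValue b c + 5)) = true := by
  decide +kernel

/-- At the right angle both leg strips end on the same slice. A codeword in the corner lies on two
legs, hence the factor 2. -/
theorem topValue_corner :
    ((masks 6).all fun a => (masks 6).all fun b => !(compat a b) || (masks 6).all fun c =>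
      !(compat c b && compatMid a c) ||
        Nat.ble (topValue a b + topValue c b + 2 * bit b 0 + sumUpTo (coverMid a b c) 5) 15)
      = true := by
  decide +kernel

/-- Diagonal analogue of `topValue_step`, with all quantities doubled: three cells give 6, and a
diagonal codeword saving two cells gives 4. The statement is symmetric in the two odd slices around
`e`, so one table serves both directions of travel. -/
theorem diagValue_even :
    ((masks 4).all fun e => (masks 3).all fun o => !(compatDiag e o) || (masks 3).all fun o' =>
      !(compatDiag e o' && compatMid o o') ||
        decide (diagValue e o + diagValue e o' + 4 * bit e 3 +
          2 * (popc 4 e - bit e 0 + popc 3 o + popc 3 o' + popc 3 (o >>> 1) + popc 3 (o' >>> 1) : ℤ)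
            ≤ 6)) = true := by
  decide +kernel

theorem diagValue_odd :
    ((masks 3).all fun o => (masks 4).all fun e => !(compatDiag e o) || (masks 4).all fun e' =>
      !(compatDiag e' o && compatMid e e') ||
        decide (2 * (popc 3 o + popc 3 e + popc 3 (e >>> 1) + popc 3 e' + popc 3 (e' >>> 1) : ℤ)
          ≤ diagValue e o + diagValue e' o + 6)) = true := by
  decide +kernel

/-! ### Mask tests in terms of binary digits -/

theorem beq_land_zero_iff {x y : ℕ} :
    Nat.beq (x &&& y) 0 = true ↔ ∀ i, x.testBit i = true → y.testBit i = false := by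
  rw [Nat.beq_eq]
  constructor
  · intro h i hx
    have := congrArg (fun z => Nat.testBit z i) h
    simpa [hx] using this
  · intro h
    apply Nat.eq_of_testBit_eq
    intro i
    have := h i
    cases hx : x.testBit i <;> simp_all

theorem sparse_iff {a : ℕ} :
    sparse a = true ↔ ∀ i, ¬(a.testBit i = true ∧ a.testBit (i + 1) = true) := by
  rw [sparse, beq_land_zero_iff]
  constructor
  · rintro h i ⟨h0, h1⟩
    have := h (i + 1) h1
    simp [h0] at this
  · intro h i hi
    rcases i with _ | i
    · simp
    · have := h i
      simp_all

theorem compat_iff {a b : ℕ} :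
    compat a b = true ↔ ∀ i, a.testBit i = true → b.testBit i = false ∧ b.testBit (i + 1) = false := by
  rw [compat, beq_land_zero_iff]
  constructor
  · intro h i hi
    constructor
    · by_contra hb
      have := h i (by simpa using hb)
      simp [hi] at this
    · by_contra hb
      have := h (i + 1) (by simpa using hb)
      simp [hi] at this
  · intro h i hi
    have h0 := h i
    rcases i with _ | i
    · cases ha : a.testBit 0
      · simpa using ha
      · rw [(h0 ha).1] at hi
        simp at hi
    · have h1 := h i
      cases ha : a.testBit i <;> cases ha' : a.testBit (i + 1) <;> simp_all

theorem compatTwo_iff {a c : ℕ} :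
    compatTwo a c = true ↔ ∀ i, a.testBit i = true →
      c.testBit i = false ∧ c.testBit (i + 1) = false ∧ c.testBit (i + 2) = false := by
  rw [compatTwo, beq_land_zero_iff]
  constructor
  · intro h i hi
    refine ⟨?_, ?_, ?_⟩
    · by_contra hb
      have := h i (by simpa using hb)
      simp [hi] at this
    · by_contra hb
      have := h (i + 1) (by simpa using hb)
      simp [hi] at this
    · by_contra hb
      have := h (i + 2) (by simpa using hb)
      simp [hi] at this
  · intro h i hi
    have h0 := h i
    have h1 := h (i - 1)
    have h2 := h (i - 2)
    rcases i with _ | _ | i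
    · cases ha : a.testBit 0 <;> simp_all
    · cases ha : a.testBit 0 <;> cases ha' : a.testBit 1 <;> simp_all
    · cases ha : a.testBit i <;> cases ha' : a.testBit (i + 1) <;>
        cases ha' : a.testBit (i + 2) <;> simp_all

theorem compatMid_iff {a c : ℕ} :
    compatMid a c = true ↔ ∀ i, (a.testBit i = true →
      c.testBit i = false ∧ c.testBit (i + 1) = false) ∧
      (a.testBit (i + 1) = true → c.testBit i = false) := by
  rw [compatMid, beq_land_zero_iff]
  constructor
  · intro h i
    refine ⟨fun hi => ⟨?_, ?_⟩, fun hi => ?_⟩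
    · by_contra hb
      have := h i (by simpa using hb)
      simp [hi] at this
    · by_contra hb
      have := h (i + 1) (by simpa using hb)
      simp [hi] at this
    · by_contra hb
      have := h i (by simpa using hb)
      simp [hi, Nat.add_comm 1 i] at this
  · intro h i hi
    have h0 := h i
    rcases i with _ | i
    · cases ha : a.testBit 0 <;> cases ha' : a.testBit 1 <;> simp_all
    · have h1 := h i
      cases ha : a.testBit i <;> cases ha' : a.testBit (i + 1) <;>
        cases ha' : a.testBit (i + 2) <;> simp_all [Nat.add_comm 1]

theorem compatDiag_iff {e o : ℕ} :
    compatDiag e o = true ↔ ∀ i, o.testBit i = true →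
      e.testBit i = false ∧ e.testBit (i + 1) = false := by
  rw [compatDiag, beq_land_zero_iff]
  simp [Nat.add_comm 1]

theorem mem_masks {h a : ℕ} (ha : a < 2 ^ h) (hs : sparse a = true) : a ∈ masks h := by
  simp [masks, ha, hs]

theorem popc_eq_sum (k x : ℕ) : popc k x = ∑ i ∈ Finset.range k, bit x i := by
  induction k with
  | zero => rfl
  | succ k ih => rw [Finset.sum_range_succ, popc, ih]

theorem sumUpTo_eq_sum (f : ℕ → ℕ) (k : ℕ) : sumUpTo f k = ∑ i ∈ Finset.range k, f i := by
  induction k with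
  | zero => rfl
  | succ k ih => rw [Finset.sum_range_succ, sumUpTo, ih]

theorem bit_eq_zero_of_lt {x h i : ℕ} (hx : x < 2 ^ h) (hi : h ≤ i) : bit x i = 0 := by
  rw [bit, Nat.testBit_lt_two_pow (hx.trans_le (Nat.pow_le_pow_right (by norm_num) hi))]
  rfl

theorem popc_eq_of_lt {x h k : ℕ} (hx : x < 2 ^ h) (hk : h ≤ k) : popc k x = popc h x := by
  rw [popc_eq_sum, popc_eq_sum]
  symm
  apply Finset.sum_subset (by simpa using hk)
  intro i _ hi
  exact bit_eq_zero_of_lt hx (by simpa using hi)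

@[simp] theorem bit_shiftRight (x k i : ℕ) : bit (x >>> k) i = bit x (k + i) := by
  simp [bit]

@[simp] theorem bit_shiftLeft_one_succ (x i : ℕ) : bit (x <<< 1) (i + 1) = bit x i := by
  simp [bit]

@[simp] theorem bit_shiftLeft_one_zero (x : ℕ) : bit (x <<< 1) 0 = 0 := by
  simp [bit]

theorem bit_mod_two_pow {x k i : ℕ} (hi : i < k) : bit (x % 2 ^ k) i = bit x i := by
  simp [bit, hi]

/-! ### Slice sequences and the dynamic program -/

/-- The masks on the slices of a packing of a triangular region. -/
structure IsSliceSequence (m : ℕ → ℕ) : Prop where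
  lt : ∀ s, m s < 2 ^ (s / 2)
  sparse : ∀ s, sparse (m s) = true
  compat : ∀ s, compat (m s) (m (s + 1)) = true
  compatTwo : ∀ s, compatTwo (m s) (m (s + 2)) = true

/-- The number of codewords on slice `s`. -/
def sliceCard (m : ℕ → ℕ) (s : ℕ) : ℕ := popc (s / 2) (m s)

theorem popc_eq_sliceCard {m : ℕ → ℕ} (hm : IsSliceSequence m) {s k : ℕ} (h : s / 2 ≤ k) :
    popc k (m s) = sliceCard m s := popc_eq_of_lt (hm.lt s) h

theorem le_bestValue {c a v : ℕ} {l : List (ℕ × ℕ)} (h : (a, v) ∈ l)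
    (hc : compatTwo a c = true) : v ≤ bestValue c l := by
  induction l with
  | nil => simp at h
  | cons x l ih =>
    rw [bestValue, List.foldr_cons]
    rcases List.mem_cons.1 h with rfl | h'
    · simp [hc]
    · have := ih h'
      rw [bestValue] at this
      cases compatTwo x.1 c
      · simpa using this
      · simpa using Or.inr this

/-- The tables of transfer values bound the number of codewords on the first slices. -/
theorem exists_mem_sliceTable {m : ℕ → ℕ} (hm : IsSliceSequence m) (k : ℕ) (hk : k ≤ 15) :
    ∃ l v, (m (k + 1), l) ∈ sliceTable k ∧ (m k, v) ∈ l ∧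
      ∑ r ∈ Finset.range (k + 1), sliceCard m r ≤ v := by
  induction k with
  | zero =>
    have h0 : m 0 = 0 := by simpa using hm.lt 0
    have h1 : m 1 = 0 := by simpa using hm.lt 1
    exact ⟨[(0, 0)], 0, by simp [sliceTable, h1], by simp [h0], by simp [sliceCard, popc]⟩
  | succ k ih =>
    obtain ⟨l, v, hl, hv, hle⟩ := ih (by omega)
    refine ⟨_, bestValue (m (k + 2)) l + popc 8 (m (k + 1)),
      List.mem_map.2 ⟨m (k + 2), mem_masks (hm.lt (k + 2)) (hm.sparse _), rfl⟩,
      List.mem_map.2 ⟨(m (k + 1), l), List.mem_filter.2 ⟨hl, hm.compat (k + 1)⟩, rfl⟩, ?_⟩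
    -- Eight digits are enough, since slices up to 16 have at most eight cells.
    rw [Finset.sum_range_succ, popc_eq_sliceCard hm (by omega)]
    have := le_bestValue hv (hm.compatTwo k)
    omega

/-! ### The potential along a leg -/

theorem testBit_mod_of {x k i : ℕ} (h : (x % 2 ^ k).testBit i = true) : x.testBit i = true := by
  rw [Nat.testBit_mod_two_pow] at h
  simp_all

theorem sparse_mod {a : ℕ} (k : ℕ) (h : sparse a = true) : sparse (a % 2 ^ k) = true :=
  sparse_iff.2 fun i hi => sparse_iff.1 h i ⟨testBit_mod_of hi.1, testBit_mod_of hi.2⟩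

theorem testBit_mod_false {x : ℕ} (k : ℕ) {i : ℕ} (h : x.testBit i = false) :
    (x % 2 ^ k).testBit i = false := by
  rw [Nat.testBit_mod_two_pow, h, Bool.and_false]

theorem compat_mod {a b : ℕ} (k : ℕ) (h : compat a b = true) :
    compat (a % 2 ^ k) (b % 2 ^ k) = true :=
  compat_iff.2 fun i hi => (compat_iff.1 h i (testBit_mod_of hi)).imp
    (testBit_mod_false k) (testBit_mod_false k)

theorem compatTwo_mod {a b : ℕ} (k : ℕ) (h : compatTwo a b = true) :
    compatTwo (a % 2 ^ k) (b % 2 ^ k) = true :=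
  compatTwo_iff.2 fun i hi => (compatTwo_iff.1 h i (testBit_mod_of hi)).imp
    (testBit_mod_false k) (And.imp (testBit_mod_false k) (testBit_mod_false k))

theorem compatMid_mod {a b : ℕ} (k : ℕ) (h : compatMid a b = true) :
    compatMid (a % 2 ^ k) (b % 2 ^ k) = true :=
  compatMid_iff.2 fun i => ⟨fun hi => ((compatMid_iff.1 h i).1 (testBit_mod_of hi)).imp
    (testBit_mod_false k) (testBit_mod_false k),
    fun hi => testBit_mod_false k ((compatMid_iff.1 h i).2 (testBit_mod_of hi))⟩

theorem mod_mem_masks {a : ℕ} (k : ℕ) (h : sparse a = true) : a % 2 ^ k ∈ masks k :=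
  mem_masks (Nat.mod_lt _ (by positivity)) (sparse_mod k h)

theorem sumUpTo_cover_mod (a b c : ℕ) :
    sumUpTo (cover (a % 2 ^ 6) (b % 2 ^ 6) (c % 2 ^ 6)) 5 = sumUpTo (cover a b c) 5 := by
  rw [sumUpTo_eq_sum, sumUpTo_eq_sum]
  refine Finset.sum_congr rfl fun i hi => ?_
  rw [Finset.mem_range] at hi
  rcases i with _ | i
  · simp only [cover, bit_shiftRight, bit_shiftLeft_one_zero, bit_mod_two_pow (show 0 < 6 by omega),
      bit_mod_two_pow (show 1 + 0 < 6 by omega)]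
  · simp only [cover, bit_shiftRight, bit_shiftLeft_one_succ, bit_mod_two_pow (show i < 6 by omega),
      bit_mod_two_pow (show i + 1 < 6 by omega), bit_mod_two_pow (show 1 + (i + 1) < 6 by omega)]

theorem sumUpTo_coverMid_mod (a b c : ℕ) :
    sumUpTo (coverMid (a % 2 ^ 6) (b % 2 ^ 6) (c % 2 ^ 6)) 5 = sumUpTo (coverMid a b c) 5 := by
  rw [sumUpTo_eq_sum, sumUpTo_eq_sum]
  refine Finset.sum_congr rfl fun i hi => ?_
  rw [Finset.mem_range] at hi
  rcases i with _ | i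
  · simp only [coverMid, bit_shiftLeft_one_zero, bit_mod_two_pow (show 0 < 6 by omega)]
  · simp only [coverMid, bit_shiftLeft_one_succ, bit_mod_two_pow (show i < 6 by omega),
      bit_mod_two_pow (show i + 1 < 6 by omega)]

/-- The potential of the top ends of slices `k` and `k + 1`. -/
def topPotential (m : ℕ → ℕ) (k : ℕ) : ℕ := topValue (m k % 2 ^ 6) (m (k + 1) % 2 ^ 6)

theorem topPotential_step {m : ℕ → ℕ} (hm : IsSliceSequence m) (k : ℕ) :
    topPotential m k + bit (m (k + 1)) 0 +
      sumUpTo (cover (m k) (m (k + 1)) (m (k + 2))) 5 ≤ topPotential m (k + 1) + 5 := by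
  have h := topValue_step
  simp only [List.all_eq_true, Bool.or_eq_true, Bool.not_eq_true', Nat.ble_eq] at h
  have h1 := (h _ (mod_mem_masks 6 (hm.sparse k)) _
    (mod_mem_masks 6 (hm.sparse (k + 1)))).resolve_left (by rw [compat_mod 6 (hm.compat k)]; simp)
  have h2 := (h1 _ (mod_mem_masks 6 (hm.sparse (k + 2)))).resolve_left
    (by rw [compat_mod 6 (hm.compat (k + 1)), compatTwo_mod 6 (hm.compatTwo k)]; simp)
  rw [sumUpTo_cover_mod, bit_mod_two_pow (by norm_num)] at h2
  exact h2

theorem topPotential_corner {m m' : ℕ → ℕ} (hm : IsSliceSequence m) (hm' : IsSliceSequence m')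
    {n : ℕ} (hb : m' (n + 1) = m (n + 1)) (hmid : compatMid (m n) (m' n) = true) :
    topPotential m n + topPotential m' n + 2 * bit (m (n + 1)) 0 +
      sumUpTo (coverMid (m n) (m (n + 1)) (m' n)) 5 ≤ 15 := by
  have h := topValue_corner
  simp only [List.all_eq_true, Bool.or_eq_true, Bool.not_eq_true', Nat.ble_eq] at h
  have hc := hm'.compat n
  rw [hb] at hc
  have h1 := (h _ (mod_mem_masks 6 (hm.sparse n)) _
    (mod_mem_masks 6 (hm.sparse (n + 1)))).resolve_left (by rw [compat_mod 6 (hm.compat n)]; simp)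
  have h2 := (h1 _ (mod_mem_masks 6 (hm'.sparse n))).resolve_left
    (by rw [compat_mod 6 hc, compatMid_mod 6 hmid]; simp)
  rw [sumUpTo_coverMid_mod, bit_mod_two_pow (by norm_num)] at h2
  rw [topPotential, topPotential, hb]
  exact h2

/-! ### The potential along the diagonal -/

theorem shiftRight_lt_two_pow {x h k : ℕ} (hx : x < 2 ^ (h + k)) : x >>> h < 2 ^ k := by
  rw [Nat.shiftRight_eq_div_pow]
  exact Nat.div_lt_of_lt_mul (by rwa [← pow_add])

theorem sparse_shiftRight {a : ℕ} (k : ℕ) (h : sparse a = true) : sparse (a >>> k) = true := by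
  rw [sparse_iff] at h ⊢
  intro i
  simpa [add_assoc] using h (k + i)

theorem IsSliceSequence.shiftRight_mem_masks {m : ℕ → ℕ} (hm : IsSliceSequence m) {s h k : ℕ}
    (hs : s / 2 = h + k) : m s >>> h ∈ masks k :=
  mem_masks (shiftRight_lt_two_pow (hs ▸ hm.lt s)) (sparse_shiftRight _ (hm.sparse s))

theorem cover_succ (a b c i : ℕ) : cover a b c (i + 1) =
    bit b (i + 1) + bit c (i + 1) + bit c (i + 2) + bit a (i + 1) + bit a i := by
  rw [cover, bit_shiftLeft_one_succ, bit_shiftRight, show 1 + (i + 1) = i + 2 by ring]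

/-- The potential of the diagonal ends of slices `k` and `k + 1`. -/
def diagPotential (m : ℕ → ℕ) (k : ℕ) : ℤ :=
  if k % 2 = 0 then diagValue (m k >>> (k / 2 - 4)) (m (k + 1) >>> ((k + 1) / 2 - 3))
  else -diagValue (m (k + 1) >>> ((k + 1) / 2 - 4)) (m k >>> (k / 2 - 3))

/-- The codeword indicator of the diagonal cell on slice `s`, if there is such a cell. -/
def diagBit (m : ℕ → ℕ) (s : ℕ) : ℕ := if s % 2 = 0 then bit (m s) (s / 2 - 1) else 0

theorem diagPotential_step_odd {m : ℕ → ℕ} (hm : IsSliceSequence m) (h : ℕ) :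
    diagPotential m (2 * (h + 4) + 1) + 2 * (∑ i ∈ Finset.range 3,
      cover (m (2 * (h + 4))) (m (2 * (h + 4) + 1)) (m (2 * (h + 4) + 2)) (h + i + 1) : ℕ) ≤
    diagPotential m (2 * (h + 4)) + 6 := by
  have H := diagValue_odd
  simp only [List.all_eq_true, Bool.or_eq_true, Bool.not_eq_true', decide_eq_true_eq] at H
  set s := 2 * (h + 4) with hs
  have e1 : s / 2 = h + 4 := by omega
  have e2 : (s + 1) / 2 = h + 1 + 3 := by omega
  have e3 : (s + 2) / 2 = h + 1 + 4 := by omega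
  have h1 := (H _ (hm.shiftRight_mem_masks e2) _ (hm.shiftRight_mem_masks e1)).resolve_left (by
    rw [Bool.not_eq_false, compatDiag_iff]
    intro i hi
    have h0 := compat_iff.1 (hm.compat s) (h + i)
    have h1 := compat_iff.1 (hm.compat s) (h + (i + 1))
    simp only [Nat.testBit_shiftRight] at hi ⊢
    -- The odd mask is shifted by one more than the even mask below it, so its digit i is adjacent
    -- to digits i and i + 1 of the even mask.
    have e : h + (i + 1) = h + 1 + i := by ring
    have e' : h + i + 1 = h + 1 + i := by ring
    rw [e] at h1 ⊢
    rw [e'] at h0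
    constructor
    · by_contra hc
      simp_all
    · by_contra hc
      simp_all)
  have h2 := (h1 _ (hm.shiftRight_mem_masks e3)).resolve_left (by
    rw [Bool.not_eq_false, Bool.and_eq_true, compatDiag_iff, compatMid_iff]
    constructor
    · intro i hi
      have h0 := compat_iff.1 (hm.compat (s + 1)) (h + 1 + i)
      simp only [Nat.testBit_shiftRight] at hi ⊢
      exact h0 hi
    · intro i
      have h0 := compatTwo_iff.1 (hm.compatTwo s) (h + i)
      have h1 := compatTwo_iff.1 (hm.compatTwo s) (h + (i + 1))
      simp only [Nat.testBit_shiftRight]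
      have e : h + (i + 1) = h + 1 + i := by ring
      have e' : h + i + 1 = h + 1 + i := by ring
      have e'' : h + 1 + (i + 1) = h + i + 2 := by ring
      rw [e] at h1 ⊢
      rw [e''] 
      rw [e'] at h0
      exact ⟨fun hi => (h0 hi).2, fun hi => (h1 hi).1⟩)
  have hmod : s % 2 = 0 := by omega
  have hmod' : (s + 1) % 2 ≠ 0 := by omega
  rw [diagPotential, if_neg hmod', diagPotential, if_pos hmod, e1, e2,
    show s + 1 + 1 = s + 2 from rfl, e3, show h + 4 - 4 = h by omega,
    show h + 1 + 3 - 3 = h + 1 by omega, show h + 1 + 4 - 4 = h + 1 by omega]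
  simp only [popc_eq_sum, Finset.sum_range_succ, Finset.sum_range_zero, bit_shiftRight, add_assoc,
    Nat.reduceAdd, zero_add, add_zero] at h2
  simp only [Finset.sum_range_succ, Finset.sum_range_zero, cover_succ, add_assoc, Nat.reduceAdd,
    zero_add]
  push_cast at h2 ⊢
  linarith

theorem diagPotential_step_even {m : ℕ → ℕ} (hm : IsSliceSequence m) (h : ℕ) :
    diagPotential m (2 * (h + 4) + 2) + 4 * diagBit m (2 * (h + 4) + 2) + 2 *
      (∑ i ∈ Finset.range 3, cover (m (2 * (h + 4) + 1)) (m (2 * (h + 4) + 2))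
        (m (2 * (h + 4) + 3)) (h + 1 + i + 1) : ℕ) ≤
    diagPotential m (2 * (h + 4) + 1) + 6 := by
  have H := diagValue_even
  simp only [List.all_eq_true, Bool.or_eq_true, Bool.not_eq_true', decide_eq_true_eq] at H
  set s := 2 * (h + 4) with hs
  have e1 : (s + 1) / 2 = h + 1 + 3 := by omega
  have e2 : (s + 2) / 2 = h + 1 + 4 := by omega
  have e3 : (s + 3) / 2 = h + 2 + 3 := by omega
  have h1 := (H _ (hm.shiftRight_mem_masks e2) _ (hm.shiftRight_mem_masks e1)).resolve_left (by
    rw [Bool.not_eq_false, compatDiag_iff]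
    intro i hi
    have h0 := compat_iff.1 (hm.compat (s + 1)) (h + 1 + i)
    simp only [Nat.testBit_shiftRight] at hi ⊢
    exact h0 hi)
  have h2 := (h1 _ (hm.shiftRight_mem_masks e3)).resolve_left (by
    rw [Bool.not_eq_false, Bool.and_eq_true, compatDiag_iff, compatMid_iff]
    constructor
    · intro i hi
      have h0 := compat_iff.1 (hm.compat (s + 2)) (h + 1 + i)
      have h1 := compat_iff.1 (hm.compat (s + 2)) (h + 1 + (i + 1))
      simp only [Nat.testBit_shiftRight] at hi ⊢
      have e : h + 1 + (i + 1) = h + 2 + i := by ring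
      have e' : h + 1 + i + 1 = h + 2 + i := by ring
      rw [e] at h1 ⊢
      rw [e'] at h0
      constructor
      · by_contra hc
        simp_all
      · by_contra hc
        simp_all
    · intro i
      have h0 := compatTwo_iff.1 (hm.compatTwo (s + 1)) (h + 1 + i)
      have h1 := compatTwo_iff.1 (hm.compatTwo (s + 1)) (h + 1 + (i + 1))
      simp only [Nat.testBit_shiftRight]
      have e : h + 1 + (i + 1) = h + 2 + i := by ring
      have e' : h + 1 + i + 1 = h + 2 + i := by ring
      have e'' : h + 2 + (i + 1) = h + 1 + i + 2 := by ring
      rw [e] at h1 ⊢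
      rw [e'']
      rw [e'] at h0
      exact ⟨fun hi => (h0 hi).2, fun hi => (h1 hi).1⟩)
  have hmod : (s + 1) % 2 ≠ 0 := by omega
  have hmod' : (s + 2) % 2 = 0 := by omega
  rw [diagPotential, if_pos hmod', diagPotential, if_neg hmod, e1, e2, diagBit, if_pos hmod', e2,
    show s + 1 + 1 = s + 2 from rfl, show s + 2 + 1 = s + 3 from rfl, e3,
    show h + 1 + 4 - 4 = h + 1 by omega, show h + 1 + 4 - 1 = h + 4 by omega,
    show h + 1 + 3 - 3 = h + 1 by omega, show h + 2 + 3 - 3 = h + 2 by omega]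
  simp only [popc_eq_sum, Finset.sum_range_succ, Finset.sum_range_zero, bit_shiftRight, add_assoc,
    Nat.reduceAdd, zero_add, add_zero] at h2
  simp only [Finset.sum_range_succ, Finset.sum_range_zero, cover_succ, add_assoc, Nat.reduceAdd,
    zero_add]
  push_cast at h2 ⊢
  linarith

/-! ### Double counting of covered cells -/

theorem bit_eq_one_or_zero (x i : ℕ) :
    (bit x i = 1 ∧ x.testBit i = true) ∨ (bit x i = 0 ∧ x.testBit i = false) := by
  unfold bit
  cases x.testBit i <;> simp

/-- Two codewords covering the same cell would be at distance at most 2. -/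
theorem cover_le_one {m : ℕ → ℕ} (hm : IsSliceSequence m) (s i : ℕ) :
    cover (m s) (m (s + 1)) (m (s + 2)) i ≤ 1 := by
  have b0 := bit_eq_one_or_zero (m (s + 1)) i
  have c0 := bit_eq_one_or_zero (m (s + 2)) i
  have c1 := bit_eq_one_or_zero (m (s + 2)) (i + 1)
  have a1 := bit_eq_one_or_zero (m s) i
  have hc := sparse_iff.1 (hm.sparse (s + 2)) i
  have hbc := compat_iff.1 (hm.compat (s + 1)) i
  have hab := compat_iff.1 (hm.compat s) i
  have hac := compatTwo_iff.1 (hm.compatTwo s) i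
  rcases i with _ | i
  · simp only [cover, bit_shiftRight, bit_shiftLeft_one_zero, Nat.add_comm 1 0]
    grind
  · have a0 := bit_eq_one_or_zero (m s) i
    have ha := sparse_iff.1 (hm.sparse s) i
    have hab' := compat_iff.1 (hm.compat s) i
    have hac' := compatTwo_iff.1 (hm.compatTwo s) i
    rw [cover_succ]
    grind

theorem sum_bit_succ (x k : ℕ) :
    ∑ i ∈ Finset.range k, bit x (i + 1) + bit x 0 = popc (k + 1) x := by
  rw [popc_eq_sum, Finset.sum_range_succ']

theorem sum_bit_shiftLeft (x k : ℕ) :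
    ∑ i ∈ Finset.range (k + 1), bit (x <<< 1) i = popc k x := by
  rw [popc_eq_sum, Finset.sum_range_succ']
  simp

theorem diagBit_of_odd (m : ℕ → ℕ) {s : ℕ} (h : s % 2 = 1) : diagBit m s = 0 := by
  simp [diagBit, h]

/-- Double counting of the codewords covering the cells of a slice. -/
theorem sum_cover {m : ℕ → ℕ} (hm : IsSliceSequence m) {s : ℕ} (hs : 1 ≤ s) :
    ∑ i ∈ Finset.range ((s + 1) / 2), cover (m s) (m (s + 1)) (m (s + 2)) i +
      (bit (m (s + 2)) 0 + diagBit m (s + 2) + diagBit m s) =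
    sliceCard m (s + 1) + 2 * sliceCard m (s + 2) + 2 * sliceCard m s := by
  have hb : ∑ i ∈ Finset.range ((s + 1) / 2), bit (m (s + 1)) i = sliceCard m (s + 1) :=
    (popc_eq_sum _ _).symm
  have hc' : ∑ i ∈ Finset.range ((s + 1) / 2), bit (m (s + 2) >>> 1) i + bit (m (s + 2)) 0 =
      sliceCard m (s + 2) := by
    rw [← popc_eq_sliceCard hm (show (s + 2) / 2 ≤ (s + 1) / 2 + 1 by omega), ← sum_bit_succ]
    simp [Nat.add_comm 1]
  simp only [cover, Finset.sum_add_distrib]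
  -- For odd s the two outer slices have no diagonal cell. For even s the last codeword of each may
  -- be diagonal, and then it reaches only one cell of the middle slice.
  obtain ⟨h, rfl | rfl⟩ : ∃ h, s = 2 * h + 1 ∨ s = 2 * (h + 1) := ⟨(s - 1) / 2, by omega⟩
  · rw [diagBit_of_odd m (s := 2 * h + 1 + 2) (by omega),
      diagBit_of_odd m (s := 2 * h + 1) (by omega)]
    have hc : ∑ i ∈ Finset.range ((2 * h + 1 + 1) / 2), bit (m (2 * h + 1 + 2)) i =
        sliceCard m (2 * h + 1 + 2) := by
      rw [← popc_eq_sum, popc_eq_sliceCard hm (by omega)]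
    have ha : ∑ i ∈ Finset.range ((2 * h + 1 + 1) / 2), bit (m (2 * h + 1)) i =
        sliceCard m (2 * h + 1) := by
      rw [← popc_eq_sum, popc_eq_sliceCard hm (by omega)]
    have ha' : ∑ i ∈ Finset.range ((2 * h + 1 + 1) / 2), bit (m (2 * h + 1) <<< 1) i =
        sliceCard m (2 * h + 1) := by
      rw [show (2 * h + 1 + 1) / 2 = h + 1 by omega, sum_bit_shiftLeft,
        popc_eq_sliceCard hm (by omega)]
    omega
  · have hd : diagBit m (2 * (h + 1)) = bit (m (2 * (h + 1))) h := by
      rw [diagBit, if_pos (by omega), show 2 * (h + 1) / 2 - 1 = h by omega]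
    have hd' : diagBit m (2 * (h + 1) + 2) = bit (m (2 * (h + 1) + 2)) (h + 1) := by
      rw [diagBit, if_pos (by omega), show (2 * (h + 1) + 2) / 2 - 1 = h + 1 by omega]
    have hc : ∑ i ∈ Finset.range ((2 * (h + 1) + 1) / 2), bit (m (2 * (h + 1) + 2)) i +
        bit (m (2 * (h + 1) + 2)) (h + 1) = sliceCard m (2 * (h + 1) + 2) := by
      rw [show (2 * (h + 1) + 1) / 2 = h + 1 by omega, ← Finset.sum_range_succ, ← popc_eq_sum,
        popc_eq_sliceCard hm (by omega)]
    have ha : ∑ i ∈ Finset.range ((2 * (h + 1) + 1) / 2), bit (m (2 * (h + 1))) i =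
        sliceCard m (2 * (h + 1)) := by
      rw [← popc_eq_sum, popc_eq_sliceCard hm (by omega)]
    have ha' : ∑ i ∈ Finset.range ((2 * (h + 1) + 1) / 2), bit (m (2 * (h + 1)) <<< 1) i +
        bit (m (2 * (h + 1))) h = sliceCard m (2 * (h + 1)) := by
      rw [show (2 * (h + 1) + 1) / 2 = h + 1 by omega, sum_bit_shiftLeft, popc_eq_sum,
        ← Finset.sum_range_succ, ← popc_eq_sum, popc_eq_sliceCard hm (by omega)]
    omega

/-- On a long slice at most one codeword covers each cell that is far from both ends. -/
theorem sum_cover_le {m : ℕ → ℕ} (hm : IsSliceSequence m) (s h : ℕ) :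
    ∑ i ∈ Finset.range (h + 8), cover (m s) (m (s + 1)) (m (s + 2)) i ≤
      sumUpTo (cover (m s) (m (s + 1)) (m (s + 2))) 5 + h +
        ∑ i ∈ Finset.range 3, cover (m s) (m (s + 1)) (m (s + 2)) (h + 5 + i) := by
  rw [show h + 8 = 5 + h + 3 by ring, Finset.sum_range_add, Finset.sum_range_add, sumUpTo_eq_sum,
    Nat.add_comm 5 h]
  have : ∑ i ∈ Finset.range h, cover (m s) (m (s + 1)) (m (s + 2)) (5 + i) ≤
      ∑ i ∈ Finset.range h, 1 := Finset.sum_le_sum fun i _ => cover_le_one hm s _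
  simp only [Finset.sum_const, Finset.card_range, smul_eq_mul, mul_one] at this
  omega

/-- The boundary savings minus the number of uncovered cells, on the slices up to `k`. -/
def surplus (m : ℕ → ℕ) (k : ℕ) : ℤ :=
  5 * ∑ r ∈ Finset.range (k + 1), (sliceCard m r : ℤ) - 2 * sliceCard m k + diagBit m k +
    2 * sliceCard m (k + 1) - bit (m (k + 1)) 0 - diagBit m (k + 1) -
    ∑ r ∈ Finset.range (k + 1), ((r / 2 : ℕ) : ℤ)

/-- A slice with at least eight cells splits into five at the leg, a middle part covered at most
once per cell, and three at the diagonal. The diagonal part is absorbed by `diagPotential`; the leg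
part is kept explicit, with 10 = 2 · 5, so that the corner slice can be treated differently. -/
theorem surplus_step {m : ℕ → ℕ} (hm : IsSliceSequence m) {k : ℕ} (hk : 15 ≤ k) :
    2 * surplus m (k + 1) + diagPotential m (k + 1) + 10 ≤
      2 * surplus m k + diagPotential m k + 2 * bit (m (k + 1)) 0 +
        2 * sumUpTo (cover (m k) (m (k + 1)) (m (k + 2))) 5 := by
  have h1 := sum_cover hm (show 1 ≤ k by omega)
  have h2 : diagPotential m (k + 1) + 4 * diagBit m (k + 1) + 2 *
      (∑ i ∈ Finset.range 3, cover (m k) (m (k + 1)) (m (k + 2)) ((k + 1) / 2 - 3 + i) : ℕ) ≤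
      diagPotential m k + 6 := by
    obtain ⟨h, rfl | rfl⟩ : ∃ h, k = 2 * (h + 4) ∨ k = 2 * (h + 4) + 1 := ⟨k / 2 - 4, by omega⟩
    · rw [diagBit_of_odd m (by omega)]
      have := diagPotential_step_odd hm h
      rw [show (2 * (h + 4) + 1) / 2 - 3 = h + 1 by omega]
      simp only [show ∀ i, h + 1 + i = h + i + 1 by intro i; ring]
      push_cast at this ⊢
      linarith
    · have := diagPotential_step_even hm h
      rw [show (2 * (h + 4) + 1 + 1) / 2 - 3 = h + 1 + 1 by omega]
      simp only [show ∀ i, h + 1 + 1 + i = h + 1 + i + 1 by intro i; ring]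
      exact this
  have h3 := sum_cover_le hm k ((k + 1) / 2 - 8)
  rw [show (k + 1) / 2 - 8 + 8 = (k + 1) / 2 by omega,
    show (k + 1) / 2 - 8 + 5 = (k + 1) / 2 - 3 by omega] at h3
  have h4 : (((k + 1) / 2 - 8 : ℕ) : ℤ) = ((k + 1) / 2 : ℕ) - 8 := by omega
  rw [surplus, surplus, Finset.sum_range_succ _ (k + 1), Finset.sum_range_succ _ (k + 1)]
  zify at h1 h3
  rw [show k + 1 + 1 = k + 2 from rfl]
  push_cast at h1 h2 h3 h4 ⊢
  linarith

/-- The inequalities `surplus_step` and `topPotential_step` telescope, starting from the table for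
slice 15. -/
theorem surplus_le {m : ℕ → ℕ} (hm : IsSliceSequence m) {k : ℕ} (hk : 15 ≤ k) :
    2 * surplus m k + diagPotential m k ≤ 2 * topPotential m k + 1 := by
  induction k, hk using Nat.le_induction with
  | base =>
    obtain ⟨l, v, hl, hv, hle⟩ := exists_mem_sliceTable hm 15 le_rfl
    have h := sliceTable_fifteen
    simp only [List.all_eq_true, decide_eq_true_eq] at h
    have h := h _ hl _ hv
    simp only [popc_eq_sliceCard hm (show (15 + 1) / 2 ≤ 8 by norm_num),
      popc_eq_sliceCard hm (show 15 / 2 ≤ 8 by norm_num)] at h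
    have hd : diagBit m (15 + 1) = bit (m (15 + 1)) 7 := rfl
    have hd' : diagBit m 15 = 0 := rfl
    have hD : diagPotential m 15 = -diagValue (m (15 + 1) >>> 4) (m 15 >>> 4) := rfl
    have hT : topPotential m 15 = topValue (m 15 % 64) (m (15 + 1) % 64) := rfl
    have hS : ∑ r ∈ Finset.range (15 + 1), ((r / 2 : ℕ) : ℤ) = 56 := by decide
    rw [surplus, hd, hd', hD, hT, hS]
    zify at hle
    push_cast at h ⊢
    linarith
  | succ k hk ih =>
    have h1 := surplus_step hm hk
    have h2 := topPotential_step hm k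
    zify at h2
    linarith

/-! ### Gluing the two halves -/

theorem compatMid_of_compatTwo {a c : ℕ} (h : compatTwo a (c <<< 1) = true) :
    compatMid a c = true := by
  rw [compatMid_iff]
  intro i
  have h0 := compatTwo_iff.1 h i
  have h1 := compatTwo_iff.1 h (i + 1)
  simp at h0 h1
  exact ⟨fun hi => (h0 hi).2, fun hi => (h1 hi).1⟩

theorem sliceCard_shift {m m' : ℕ → ℕ} {n : ℕ} (hc : m (n + 2) = m' n <<< 1) :
    sliceCard m (n + 2) = sliceCard m' n := by
  rw [sliceCard, sliceCard, hc, show (n + 2) / 2 = n / 2 + 1 by omega, popc_eq_sum,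
    sum_bit_shiftLeft]

theorem diagBit_shift {m m' : ℕ → ℕ} {n : ℕ} (hn : 2 ≤ n) (hc : m (n + 2) = m' n <<< 1) :
    diagBit m (n + 2) = diagBit m' n := by
  rw [diagBit, diagBit, hc, show (n + 2) % 2 = n % 2 by omega,
    show (n + 2) / 2 - 1 = (n / 2 - 1) + 1 by omega, bit_shiftLeft_one_succ]

theorem shiftLeft_one_shiftRight_succ (x k : ℕ) : (x <<< 1) >>> (k + 1) = x >>> k := by
  apply Nat.eq_of_testBit_eq
  intro i
  simp [show k + 1 + i - 1 = k + i by omega, show 1 ≤ k + 1 + i by omega]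

/-- Reflection reverses the direction of travel along the diagonal and keeps the pair (even mask,
odd mask). The sign in `diagPotential` depends on which of the two comes first, so it flips. -/
theorem diagPotential_shift {m m' : ℕ → ℕ} {n : ℕ} (hn : 15 ≤ n) (hb : m' (n + 1) = m (n + 1))
    (hc : m (n + 2) = m' n <<< 1) : diagPotential m (n + 1) = -diagPotential m' n := by
  rw [diagPotential, diagPotential, show n + 1 + 1 = n + 2 from rfl, hb, hc]
  rcases Nat.mod_two_eq_zero_or_one n with h | h
  · rw [if_neg (by omega), if_pos h, show (n + 2) / 2 - 4 = (n / 2 - 4) + 1 by omega,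
      shiftLeft_one_shiftRight_succ]
  · rw [if_pos (by omega), if_neg (by omega), show (n + 2) / 2 - 3 = (n / 2 - 3) + 1 by omega,
      shiftLeft_one_shiftRight_succ, neg_neg]

theorem sumUpTo_cover_shift {m m' : ℕ → ℕ} {n : ℕ} (hc : m (n + 2) = m' n <<< 1) :
    sumUpTo (cover (m n) (m (n + 1)) (m (n + 2))) 5 =
      sumUpTo (coverMid (m n) (m (n + 1)) (m' n)) 5 := by
  rw [sumUpTo_eq_sum, sumUpTo_eq_sum]
  refine Finset.sum_congr rfl fun i _ => ?_
  rw [cover, coverMid, hc, bit_shiftRight, Nat.add_comm 1 i, bit_shiftLeft_one_succ]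
  ring

/-- Both sides are twice the number of cells of the triangle, counted by slices in the two halves.
-/
theorem sum_half (n : ℕ) : 2 * (∑ r ∈ Finset.range (n + 1), r / 2 +
    ∑ r ∈ Finset.range (n + 2), r / 2) = n * (n + 1) := by
  induction n with
  | zero => rfl
  | succ n ih =>
    rw [Finset.sum_range_succ _ (n + 1), Finset.sum_range_succ _ (n + 2)]
    have : (n + 1) / 2 + (n + 2) / 2 = n + 1 := by omega
    nlinarith

/-- The upper bound for packings that are cut into two halves along the slice `n + 1`. -/
theorem sliceCard_sum_le {m m' : ℕ → ℕ} (hm : IsSliceSequence m) (hm' : IsSliceSequence m')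
    {n : ℕ} (hn : 6 ≤ n) (hb : m' (n + 1) = m (n + 1)) (hc : m (n + 2) = m' n <<< 1) :
    ∑ r ∈ Finset.range (n + 1), sliceCard m r + sliceCard m (n + 1) +
      ∑ r ∈ Finset.range (n + 1), sliceCard m' r ≤ (n ^ 2 + n) / 10 + 2 := by
  have hmid : compatMid (m n) (m' n) = true := compatMid_of_compatTwo (hc ▸ hm.compatTwo n)
  rcases Nat.lt_or_ge n 15 with h15 | h15
  · obtain ⟨l, v, hl, hv, hle⟩ := exists_mem_sliceTable hm n h15.le
    obtain ⟨l', v', hl', hv', hle'⟩ := exists_mem_sliceTable hm' n h15.le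
    have h := sliceTable_small
    simp only [List.all_eq_true, Bool.or_eq_true, Bool.not_eq_true', Nat.ble_eq,
      List.mem_range] at h
    rw [hb] at hl'
    have h1 := (h n h15).resolve_left (by omega)
    have h2 := (h1 _ hl _ hl').resolve_left (by simp)
    have h3 := (h2 _ hv _ hv').resolve_left (by simp [hmid])
    simp only [popc_eq_sliceCard hm (show (n + 1) / 2 ≤ 8 by omega)] at h3
    omega
  · have h1 := surplus_le hm h15
    have h2 := surplus_le hm' h15
    have h3 := surplus_step hm h15
    have h4 := topPotential_corner hm hm' hb hmid
    have h5 := diagPotential_shift h15 hb hc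
    rw [sumUpTo_cover_shift hc, h5] at h3
    have h6 := sum_half n
    have h0 : bit (m (n + 2)) 0 = 0 := by rw [hc, bit_shiftLeft_one_zero]
    have hs' : sliceCard m' (n + 1) = sliceCard m (n + 1) := by rw [sliceCard, hb]; rfl
    have hd' : diagBit m' (n + 1) = diagBit m (n + 1) := by rw [diagBit, hb]; rfl
    -- The terms for slices straddling the cut cancel. The extra bit is the second saving of a
    -- codeword at the right-angled corner.
    have key : 5 * ((∑ r ∈ Finset.range (n + 1), sliceCard m r + sliceCard m (n + 1) +
        ∑ r ∈ Finset.range (n + 1), sliceCard m' r : ℕ) : ℤ) =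
        surplus m (n + 1) + surplus m' n + bit (m (n + 1)) 0 +
          (∑ r ∈ Finset.range (n + 1), r / 2 + ∑ r ∈ Finset.range (n + 2), r / 2 : ℕ) := by
      rw [surplus, surplus, show n + 1 + 1 = n + 2 from rfl, sliceCard_shift hc,
        diagBit_shift (by omega) hc, h0, hb, hs', hd', Finset.sum_range_succ _ (n + 1)]
      push_cast
      ring
    -- The diagonal potentials drop out. What remains beyond n² + n is at most 2 · 15 from the
    -- corner, 1 + 1 from the two halves, and −10 from the last step, that is 22.
    have h7 : 10 * (∑ r ∈ Finset.range (n + 1), sliceCard m r + sliceCard m (n + 1) +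
        ∑ r ∈ Finset.range (n + 1), sliceCard m' r) ≤ n ^ 2 + n + 22 := by
      zify at h4 h6 ⊢
      push_cast at key
      nlinarith
    -- For these remainders, adding 22 before dividing by 10 raises the integer quotient by exactly
    -- 2.
    have h8 : (n ^ 2 + n) % 10 = 0 ∨ (n ^ 2 + n) % 10 = 2 ∨ (n ^ 2 + n) % 10 = 6 := by
      have : n % 10 < 10 := Nat.mod_lt _ (by norm_num)
      rw [Nat.add_mod, Nat.pow_mod]
      interval_cases n % 10 <;> simp
    omega

/-! ### Packings of the triangle as slice sequences -/

/-- Turns grid balls into linear inequalities that `omega` can use. -/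
theorem abs_add_abs_lt_iff {a b k : ℤ} :
    |a| + |b| < k ↔ a + b < k ∧ a - b < k ∧ b - a < k ∧ -a - b < k := by
  rcases abs_cases a with ⟨ha, _⟩ | ⟨ha, _⟩ <;> rcases abs_cases b with ⟨hb, _⟩ | ⟨hb, _⟩ <;>
    rw [ha, hb] <;> omega

/-- A set of pairwise distance at least three in the triangle `1 ≤ i ≤ j ≤ n`. -/
structure IsTrianglePacking (n : ℕ) (S : Finset (ℤ × ℤ)) : Prop where
  subset : S ⊆ triangleVertices n
  dist : ∀ p ∈ S, ∀ q ∈ S, p ≠ q → 3 ≤ |p.1 - q.1| + |p.2 - q.2|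

theorem mem_triangleVertices {n : ℕ} {p : ℤ × ℤ} :
    p ∈ triangleVertices n ↔ 1 ≤ p.1 ∧ p.1 ≤ p.2 ∧ p.2 ≤ n := by
  simp only [triangleVertices, Finset.mem_filter, Finset.mem_product, Finset.mem_Icc]
  omega

/-- The mask of the slice `i + j = s` of `S`. -/
def sliceMask (S : Finset (ℤ × ℤ)) (s : ℕ) : ℕ :=
  Nat.ofBits fun i : Fin (s / 2) => decide (((i : ℤ) + 1, (s : ℤ) - i - 1) ∈ S)

theorem IsTrianglePacking.testBit_sliceMask {n : ℕ} {S : Finset (ℤ × ℤ)}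
    (hS : IsTrianglePacking n S) {s i : ℕ} :
    (sliceMask S s).testBit i = true ↔ ((i : ℤ) + 1, (s : ℤ) - i - 1) ∈ S := by
  rcases Nat.lt_or_ge i (s / 2) with h | h
  · rw [sliceMask, Nat.testBit_ofBits_lt _ _ h, decide_eq_true_iff]
  · rw [sliceMask, Nat.testBit_ofBits_ge _ _ h]
    simp only [Bool.false_eq_true, false_iff]
    intro hp
    have := mem_triangleVertices.1 (hS.subset hp)
    simp only at this
    omega

theorem IsTrianglePacking.notMem {n : ℕ} {S : Finset (ℤ × ℤ)} (hS : IsTrianglePacking n S)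
    {p q : ℤ × ℤ} (hp : p ∈ S) (hne : p ≠ q) (h : |p.1 - q.1| + |p.2 - q.2| < 3) : q ∉ S :=
  fun hq => absurd (hS.dist p hp q hq hne) (not_le.2 h)

theorem IsTrianglePacking.testBit_eq_false {n : ℕ} {S : Finset (ℤ × ℤ)}
    (hS : IsTrianglePacking n S) {s t i j : ℕ} (hi : (sliceMask S s).testBit i = true)
    (hne : i ≠ j ∨ s ≠ t)
    (h : |(i : ℤ) - j| + |(s : ℤ) - i - (t - j)| < 3) : (sliceMask S t).testBit j = false := by
  rw [← Bool.not_eq_true, hS.testBit_sliceMask]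
  refine hS.notMem (hS.testBit_sliceMask.1 hi) ?_ ?_
  · rw [Ne, Prod.mk.injEq]
    omega
  · simp only
    rw [show (i : ℤ) + 1 - (j + 1) = i - j by ring,
      show (s : ℤ) - i - 1 - (t - j - 1) = s - i - (t - j) by ring]
    exact h

theorem IsTrianglePacking.isSliceSequence {n : ℕ} {S : Finset (ℤ × ℤ)}
    (hS : IsTrianglePacking n S) : IsSliceSequence (sliceMask S) where
  lt s := Nat.ofBits_lt_two_pow _
  sparse s := sparse_iff.2 fun i hi => by
    have := hS.testBit_eq_false hi.1 (t := s) (j := i + 1) (by omega) (by rw [abs_add_abs_lt_iff]; push_cast; omega)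
    simp [this] at hi
  compat s := compat_iff.2 fun i hi =>
    ⟨hS.testBit_eq_false hi (by omega) (by rw [abs_add_abs_lt_iff]; push_cast; omega),
      hS.testBit_eq_false hi (by omega) (by rw [abs_add_abs_lt_iff]; push_cast; omega)⟩
  compatTwo s := compatTwo_iff.2 fun i hi =>
    ⟨hS.testBit_eq_false hi (by omega) (by rw [abs_add_abs_lt_iff]; push_cast; omega),
      hS.testBit_eq_false hi (by omega) (by rw [abs_add_abs_lt_iff]; push_cast; omega),
      hS.testBit_eq_false hi (by omega) (by rw [abs_add_abs_lt_iff]; push_cast; omega)⟩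

theorem IsTrianglePacking.sliceCard_sliceMask {n : ℕ} {S : Finset (ℤ × ℤ)}
    (hS : IsTrianglePacking n S) (s : ℕ) :
    sliceCard (sliceMask S) s = (S.filter fun p : ℤ × ℤ => p.1 + p.2 = s).card := by
  have : sliceCard (sliceMask S) s =
      ((Finset.range (s / 2)).filter fun i => (sliceMask S s).testBit i = true).card := by
    rw [sliceCard, popc_eq_sum, Finset.card_filter]
    refine Finset.sum_congr rfl fun i _ => ?_
    rw [bit]
    cases (sliceMask S s).testBit i <;> rfl
  rw [this]
  refine Finset.card_bij (fun i _ => ((i : ℤ) + 1, (s : ℤ) - i - 1)) ?_ ?_ ?_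
  · intro i hi
    rw [Finset.mem_filter, hS.testBit_sliceMask] at hi
    rw [Finset.mem_filter]
    exact ⟨hi.2, by ring⟩
  · intro i _ j _ h
    rw [Prod.mk.injEq] at h
    omega
  · rintro ⟨a, b⟩ hp
    rw [Finset.mem_filter] at hp
    have h1 := mem_triangleVertices.1 (hS.subset hp.1)
    have h2 := hp.2
    simp only at h1 h2
    have e : (((a - 1).toNat : ℤ) + 1, (s : ℤ) - (a - 1).toNat - 1) = (a, b) := by
      rw [Prod.mk.injEq]
      omega
    refine ⟨(a - 1).toNat, ?_, e⟩
    rw [Finset.mem_filter, hS.testBit_sliceMask, e, Finset.mem_range]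
    exact ⟨by omega, hp.1⟩

theorem IsTrianglePacking.sum_sliceCard {n : ℕ} {S : Finset (ℤ × ℤ)}
    (hS : IsTrianglePacking n S) (k : ℕ) :
    ∑ r ∈ Finset.range (k + 1), sliceCard (sliceMask S) r =
      (S.filter fun p : ℤ × ℤ => p.1 + p.2 ≤ k).card := by
  rw [Finset.card_eq_sum_card_fiberwise (f := fun p : ℤ × ℤ => (p.1 + p.2).toNat)
    (t := Finset.range (k + 1))]
  · refine Finset.sum_congr rfl fun r hr => ?_
    rw [hS.sliceCard_sliceMask, Finset.filter_filter]
    congr 1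
    refine Finset.filter_congr fun p hp => ?_
    have := mem_triangleVertices.1 (hS.subset hp)
    rw [Finset.mem_range] at hr
    omega
  · intro p hp
    rw [Finset.mem_coe, Finset.mem_filter] at hp
    rw [Finset.mem_coe, Finset.mem_range]
    show (p.1 + p.2).toNat < k + 1
    omega

/-- The reflection of the triangle that exchanges its two legs. -/
def mirror (n : ℕ) : ℤ × ℤ ↪ ℤ × ℤ where
  toFun p := (n + 1 - p.2, n + 1 - p.1)
  inj' p q h := by
    rw [Prod.mk.injEq] at h
    exact Prod.ext (by omega) (by omega)

theorem mirror_apply (n : ℕ) (p : ℤ × ℤ) : mirror n p = (n + 1 - p.2, n + 1 - p.1) := rfl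

theorem mem_map_mirror {n : ℕ} {S : Finset (ℤ × ℤ)} {a b : ℤ} :
    (a, b) ∈ S.map (mirror n) ↔ ((n : ℤ) + 1 - b, (n : ℤ) + 1 - a) ∈ S := by
  rw [Finset.mem_map]
  constructor
  · rintro ⟨⟨c, d⟩, hp, h⟩
    simp only [mirror_apply, Prod.mk.injEq] at h
    rwa [← h.1, ← h.2, sub_sub_cancel, sub_sub_cancel]
  · intro h
    exact ⟨_, h, by simp [mirror_apply]⟩

theorem IsTrianglePacking.map_mirror {n : ℕ} {S : Finset (ℤ × ℤ)} (hS : IsTrianglePacking n S) :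
    IsTrianglePacking n (S.map (mirror n)) where
  subset := by
    rintro ⟨a, b⟩ h
    have := mem_triangleVertices.1 (hS.subset (mem_map_mirror.1 h))
    rw [mem_triangleVertices]
    simp only at this ⊢
    omega
  dist := by
    rintro ⟨a, b⟩ h ⟨c, d⟩ h' hne
    have := hS.dist _ (mem_map_mirror.1 h) _ (mem_map_mirror.1 h') (by
      intro h
      apply hne
      rw [Prod.mk.injEq] at h ⊢
      omega)
    rw [← not_lt, abs_add_abs_lt_iff] at this ⊢
    simp only at this ⊢
    omega

theorem IsTrianglePacking.card_le {n : ℕ} {S : Finset (ℤ × ℤ)} (hS : IsTrianglePacking n S)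
    (hn : 6 ≤ n) : S.card ≤ (n ^ 2 + n) / 10 + 2 := by
  have hS' := hS.map_mirror
  -- The reflection fixes slice n + 1 cell by cell.
  have hb : sliceMask (S.map (mirror n)) (n + 1) = sliceMask S (n + 1) := by
    apply Nat.eq_of_testBit_eq
    intro i
    rw [Bool.eq_iff_iff, hS.testBit_sliceMask, hS'.testBit_sliceMask, mem_map_mirror]
    push_cast
    ring_nf
  -- Slice n + 2 starts at the cell (2, n), because (1, n + 1) lies outside the triangle; hence the
  -- shift by one.
  have hc : sliceMask S (n + 2) = sliceMask (S.map (mirror n)) n <<< 1 := by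
    apply Nat.eq_of_testBit_eq
    intro i
    rw [Bool.eq_iff_iff, hS.testBit_sliceMask]
    rcases i with _ | i
    · simp only [Nat.testBit_shiftLeft]
      simp only [show ¬ (0 ≥ 1) by omega, decide_false, Bool.false_and, Bool.false_eq_true,
        iff_false]
      intro hp
      have := mem_triangleVertices.1 (hS.subset hp)
      simp only at this
      omega
    · rw [Nat.testBit_shiftLeft]
      simp only [show i + 1 ≥ 1 by omega, decide_true, Bool.true_and, Nat.add_sub_cancel]
      rw [hS'.testBit_sliceMask, mem_map_mirror]
      push_cast
      ring_nf
  have h := sliceCard_sum_le hS.isSliceSequence hS'.isSliceSequence hn hb hc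
  rw [hS.sum_sliceCard, hS'.sum_sliceCard, hS.sliceCard_sliceMask] at h
  have e : ((S.map (mirror n)).filter fun p : ℤ × ℤ => p.1 + p.2 ≤ n).card =
      (S.filter fun p : ℤ × ℤ => (n : ℤ) + 2 ≤ p.1 + p.2).card := by
    rw [Finset.filter_map, Finset.card_map]
    congr 1
    refine Finset.filter_congr fun p _ => ?_
    simp only [Function.comp_apply, mirror_apply]
    omega
  rw [e] at h
  have h1 := Finset.card_filter_add_card_filter_not (s := S) fun p : ℤ × ℤ => p.1 + p.2 ≤ n
  have h2 := Finset.card_filter_add_card_filter_not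
    (s := S.filter fun p : ℤ × ℤ => ¬ p.1 + p.2 ≤ n) fun p : ℤ × ℤ => p.1 + p.2 = (n + 1 : ℕ)
  rw [Finset.filter_filter, Finset.filter_filter] at h2
  have h3 : (S.filter fun p : ℤ × ℤ => ¬ p.1 + p.2 ≤ n ∧ p.1 + p.2 = (n + 1 : ℕ)) =
      S.filter fun p : ℤ × ℤ => p.1 + p.2 = (n + 1 : ℕ) :=
    Finset.filter_congr fun p _ => by omega
  have h4 : (S.filter fun p : ℤ × ℤ => ¬ p.1 + p.2 ≤ n ∧ ¬ p.1 + p.2 = (n + 1 : ℕ)) =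
      S.filter fun p : ℤ × ℤ => (n : ℤ) + 2 ≤ p.1 + p.2 :=
    Finset.filter_congr fun p _ => by omega
  rw [h3, h4] at h2
  omega

/-! ### Packing sets and graph isomorphisms -/

open SimpleGraph

theorem three_le_edist_iff {V : Type*} {G : SimpleGraph V} {u v : V} (h : u ≠ v) :
    3 ≤ G.edist u v ↔ ¬G.Adj u v ∧ ∀ w, ¬(G.Adj u w ∧ G.Adj w v) := by
  constructor
  · intro h3
    refine ⟨fun hadj => ?_, fun w hw => ?_⟩
    · have := h3.trans (edist_le (Walk.cons hadj Walk.nil))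
      norm_num at this
    · have := h3.trans (edist_le (Walk.cons hw.1 (Walk.cons hw.2 Walk.nil)))
      norm_num at this
  · rintro ⟨h1, h2⟩
    by_contra hlt
    rw [not_le] at hlt
    obtain ⟨p, hp⟩ := exists_walk_of_edist_ne_top (ne_top_of_lt hlt)
    rw [← hp] at hlt
    cases p with
    | nil => exact h rfl
    | cons a p =>
      cases p with
      | nil => exact h1 a
      | cons b p =>
        cases p with
        | nil => exact h2 _ ⟨a, b⟩
        | cons c p =>
          simp only [Walk.length_cons] at hlt
          have : p.length + 1 + 1 + 1 < 3 := by exact_mod_cast hlt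
          omega

theorem isPackingSet_iff {V : Type*} {G : SimpleGraph V} {S : Set V} :
    IsPackingSet G S ↔ ∀ u ∈ S, ∀ v ∈ S, u ≠ v → ¬G.Adj u v ∧ ∀ w, ¬(G.Adj u w ∧ G.Adj w v) :=
  forall₄_congr fun _ _ _ _ => forall_congr' three_le_edist_iff

theorem IsPackingSet.map_iso {V W : Type*} {G : SimpleGraph V} {H : SimpleGraph W} (e : G ≃g H)
    {S : Finset V} (hS : IsPackingSet G (S : Set V)) :
    IsPackingSet H (S.map e.toEquiv.toEmbedding : Finset W) := by
  rw [isPackingSet_iff] at hS ⊢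
  intro u hu v hv hne
  rw [Finset.mem_coe, Finset.mem_map] at hu hv
  obtain ⟨u, hu, rfl⟩ := hu
  obtain ⟨v, hv, rfl⟩ := hv
  obtain ⟨h1, h2⟩ := hS u hu v hv (by rintro rfl; exact hne rfl)
  refine ⟨fun h => h1 (e.map_adj_iff.1 h), fun w hw => h2 (e.symm w) ⟨?_, ?_⟩⟩
  · rw [← e.map_adj_iff, e.apply_symm_apply]
    exact hw.1
  · rw [← e.map_adj_iff, e.apply_symm_apply]
    exact hw.2

theorem packingNumber_congr {V W : Type*} [Finite V] [Finite W] {G : SimpleGraph V}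
    {H : SimpleGraph W} (e : G ≃g H) : packingNumber G = packingNumber H := by
  rw [packingNumber, packingNumber]
  congr 1
  ext k
  constructor
  · rintro ⟨S, hS, rfl⟩
    exact ⟨_, IsPackingSet.map_iso e hS, Finset.card_map _⟩
  · rintro ⟨S, hS, rfl⟩
    exact ⟨_, IsPackingSet.map_iso e.symm hS, Finset.card_map _⟩

/-! ### Codes and packings of Sloane's graph -/

theorem hammingNorm_comp_equiv {ι : Type*} [Fintype ι] (u : ι → ZMod 2) (σ : Equiv.Perm ι) :
    hammingNorm (u ∘ σ) = hammingNorm u :=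
  Finset.card_equiv σ fun i => by simp

theorem comp_swap_comp_swap {ι α : Type*} [DecidableEq ι] (u : ι → α) (i j : ι) :
    (u ∘ Equiv.swap i j) ∘ Equiv.swap i j = u := by
  ext k
  simp

theorem mem_transpositionBall_iff {n : ℕ} {u w : {u : Fin n → ZMod 2 // hammingNorm u = 2}} :
    w.1 ∈ transpositionBall u.1 ↔ w = u ∨ (sloaneGraph n).Adj u w := by
  rw [transpositionBall, Set.mem_ofPred_eq, sloaneGraph, fromRel_adj, ← Subtype.ext_iff]
  constructor
  · rintro (h | ⟨i, j, hij, h⟩)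
    · exact Or.inl h
    · by_cases hw : w = u
      · exact Or.inl hw
      · exact Or.inr ⟨Ne.symm hw, Or.inl ⟨i, j, hij, h⟩⟩
  · rintro (h | ⟨_, ⟨i, j, hij, h⟩ | ⟨i, j, hij, h⟩⟩)
    · exact Or.inl h
    · exact Or.inr ⟨i, j, hij, h⟩
    · exact Or.inr ⟨i, j, hij, by rw [h, comp_swap_comp_swap]⟩

theorem hammingNorm_of_mem_transpositionBall {n : ℕ} {u v : Fin n → ZMod 2}
    (h : v ∈ transpositionBall u) : hammingNorm v = hammingNorm u := by
  rcases h with rfl | ⟨i, j, _, rfl⟩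
  · rfl
  · exact hammingNorm_comp_equiv u _

theorem transpositionBall_inter_eq_empty_iff {n : ℕ}
    {u v : {u : Fin n → ZMod 2 // hammingNorm u = 2}} (hne : u ≠ v) :
    transpositionBall u.1 ∩ transpositionBall v.1 = ∅ ↔ 3 ≤ (sloaneGraph n).edist u v := by
  rw [three_le_edist_iff hne, Set.eq_empty_iff_forall_notMem]
  constructor
  · intro h
    refine ⟨fun hadj => h v.1 ⟨mem_transpositionBall_iff.2 (Or.inr hadj), Or.inl rfl⟩,
      fun w hw => h w.1 ⟨mem_transpositionBall_iff.2 (Or.inr hw.1),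
        mem_transpositionBall_iff.2 (Or.inr hw.2.symm)⟩⟩
  · rintro ⟨h1, h2⟩ w ⟨hu, hv⟩
    obtain ⟨w, rfl⟩ : ∃ w' : {u : Fin n → ZMod 2 // hammingNorm u = 2}, w'.1 = w :=
      ⟨⟨w, (hammingNorm_of_mem_transpositionBall hu).trans u.2⟩, rfl⟩
    rcases mem_transpositionBall_iff.1 hu with rfl | hu
    · rcases mem_transpositionBall_iff.1 hv with rfl | hv
      · exact hne rfl
      · exact h1 hv.symm
    · rcases mem_transpositionBall_iff.1 hv with rfl | hv
      · exact h1 hu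
      · exact h2 w ⟨hu, hv.symm⟩

theorem A085680_eq_packingNumber (n : ℕ) : A085680 n = packingNumber (sloaneGraph n) := by
  rw [A085680, packingNumber]
  congr 1
  ext k
  constructor
  · rintro ⟨C, hw, hC, rfl⟩
    refine ⟨C.subtype _, ?_, ?_⟩
    · intro u hu v hv hne
      rw [Finset.mem_coe, Finset.mem_subtype] at hu hv
      exact (transpositionBall_inter_eq_empty_iff hne).1
        (hC u.1 hu v.1 hv fun h => hne (Subtype.ext h))
    · rw [Finset.card_subtype, Finset.filter_true_of_mem hw]
  · rintro ⟨S, hS, rfl⟩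
    refine ⟨S.map (Function.Embedding.subtype _), ?_, ?_, Finset.card_map _⟩
    · intro u hu
      obtain ⟨u, _, rfl⟩ := Finset.mem_map.1 hu
      exact u.2
    · intro u hu v hv hne
      obtain ⟨u', hu', rfl⟩ := Finset.mem_map.1 (Finset.mem_coe.1 hu)
      obtain ⟨v', hv', rfl⟩ := Finset.mem_map.1 (Finset.mem_coe.1 hv)
      have hne' : u' ≠ v' := fun h => hne (congrArg _ h)
      exact (transpositionBall_inter_eq_empty_iff hne').2 (hS u' hu' v' hv' hne')

/-! ### The two-token graph of a path -/

/-- If x and y lay in the same set, that set would strictly contain the other, against equal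
cardinality. -/
theorem mem_of_symmDiff_eq_pair {V : Type*} [DecidableEq V] {A B : Finset V} {x y : V}
    (hc : A.card = B.card) (hxy : x ≠ y) (h : symmDiff A B = {x, y}) :
    (x ∈ A ∧ x ∉ B ∧ y ∈ B ∧ y ∉ A) ∨ (y ∈ A ∧ y ∉ B ∧ x ∈ B ∧ x ∉ A) := by
  have hk : ∀ k, (k ∈ A ∧ k ∉ B ∨ k ∈ B ∧ k ∉ A) ↔ k = x ∨ k = y := fun k => by
    rw [← Finset.mem_symmDiff, h, Finset.mem_insert, Finset.mem_singleton]
  have hne : A ≠ B := by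
    rintro rfl
    simpa using hk x
  have hx := (hk x).2 (Or.inl rfl)
  have hy := (hk y).2 (Or.inr rfl)
  rcases hx with hx | hx <;> rcases hy with hy | hy
  · refine absurd (Finset.eq_of_subset_of_card_le (fun k hkB => ?_) hc.le).symm hne
    by_contra hkA
    rcases (hk k).1 (Or.inr ⟨hkB, hkA⟩) with rfl | rfl
    · exact hkA hx.1
    · exact hkA hy.1
  · exact Or.inl ⟨hx.1, hx.2, hy.1, hy.2⟩
  · exact Or.inr ⟨hy.1, hy.2, hx.1, hx.2⟩
  · refine absurd (Finset.eq_of_subset_of_card_le (fun k hkA => ?_) hc.ge) hne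
    by_contra hkB
    rcases (hk k).1 (Or.inl ⟨hkA, hkB⟩) with rfl | rfl
    · exact hkB hx.1
    · exact hkB hy.1

/-- The two-element subsets correspond to the binary vectors of weight two. -/
def pairEquivVector (n : ℕ) :
    {A : Finset (Fin n) // A.card = 2} ≃ {u : Fin n → ZMod 2 // hammingNorm u = 2} where
  toFun A := ⟨fun i => if i ∈ A.1 then 1 else 0, by simp [hammingNorm, A.2]⟩
  invFun u := ⟨Finset.univ.filter fun i => u.1 i ≠ 0, u.2⟩
  left_inv A := by
    ext i
    simp
  right_inv u := by
    ext i
    have h : ∀ z : ZMod 2, (if z ≠ 0 then (1 : ZMod 2) else 0) = z := by decide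
    simpa using h (u.1 i)

theorem pairEquivVector_eq_comp_swap_iff {n : ℕ} {A B : {A : Finset (Fin n) // A.card = 2}}
    {i j : Fin n} : (pairEquivVector n B).1 = (pairEquivVector n A).1 ∘ Equiv.swap i j ↔
      ∀ k, k ∈ B.1 ↔ Equiv.swap i j k ∈ A.1 := by
  rw [funext_iff]
  refine forall_congr' fun k => ?_
  simp only [pairEquivVector, Equiv.coe_fn_mk, Function.comp_apply]
  split_ifs <;> simp_all

theorem symmDiff_eq_pair_iff {V : Type*} [DecidableEq V] {A B : Finset V} {x y : V}
    (hc : A.card = B.card) (hxy : x ≠ y) :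
    symmDiff A B = {x, y} ↔ A ≠ B ∧ ∀ k, k ∈ B ↔ Equiv.swap x y k ∈ A := by
  constructor
  · intro h
    refine ⟨?_, fun k => ?_⟩
    · rintro rfl
      simp at h
      exact Finset.insert_ne_empty x {y} h.symm
    · have hk : (k ∈ A ∧ k ∉ B ∨ k ∈ B ∧ k ∉ A) ↔ k = x ∨ k = y := by
        rw [← Finset.mem_symmDiff, h, Finset.mem_insert, Finset.mem_singleton]
      have := mem_of_symmDiff_eq_pair hc hxy h
      rcases eq_or_ne k x with rfl | hx
      · rw [Equiv.swap_apply_left]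
        tauto
      · rcases eq_or_ne k y with rfl | hy
        · rw [Equiv.swap_apply_right]
          tauto
        · rw [Equiv.swap_apply_of_ne_of_ne hx hy]
          tauto
  · rintro ⟨hne, h⟩
    have hx := h x
    have hy := h y
    rw [Equiv.swap_apply_left] at hx
    rw [Equiv.swap_apply_right] at hy
    have hxy' : ¬(x ∈ A ↔ y ∈ A) := by
      intro hiff
      apply hne
      ext k
      rw [h k]
      rcases eq_or_ne k x with rfl | hx
      · rw [Equiv.swap_apply_left, hiff]
      · rcases eq_or_ne k y with rfl | hy
        · rw [Equiv.swap_apply_right, hiff]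
        · rw [Equiv.swap_apply_of_ne_of_ne hx hy]
    ext k
    rw [Finset.mem_symmDiff, Finset.mem_insert, Finset.mem_singleton]
    rcases eq_or_ne k x with rfl | hkx
    · tauto
    · rcases eq_or_ne k y with rfl | hky
      · tauto
      · have := h k
        rw [Equiv.swap_apply_of_ne_of_ne hkx hky] at this
        tauto

/-- The two-token graph of a path is Sloane's graph. -/
def tokenGraphIsoSloaneGraph (n : ℕ) : tokenGraph 2 (pathGraph n) ≃g sloaneGraph n where
  toEquiv := pairEquivVector n
  map_rel_iff' := by
    intro A B
    have hAB : A.1.card = B.1.card := A.2.trans B.2.symm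
    rw [sloaneGraph, fromRel_adj]
    show _ ↔ ∃ x y, (pathGraph n).Adj x y ∧ symmDiff A.1 B.1 = {x, y}
    simp only [pairEquivVector_eq_comp_swap_iff, pathGraph_adj, ne_eq, EmbeddingLike.apply_eq_iff_eq]
    constructor
    · rintro ⟨hne, ⟨i, j, hij, h⟩ | ⟨i, j, hij, h⟩⟩
      · have hij' : i ≠ j := by rintro rfl; omega
        exact ⟨i, j, Or.inl hij, (symmDiff_eq_pair_iff hAB hij').2
          ⟨fun h => hne (Subtype.ext h), h⟩⟩
      · have hij' : i ≠ j := by rintro rfl; omega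
        exact ⟨i, j, Or.inl hij, symmDiff_comm A.1 B.1 ▸ (symmDiff_eq_pair_iff hAB.symm hij').2
          ⟨fun h => hne (Subtype.ext h.symm), h⟩⟩
    · rintro ⟨x, y, hadj, h⟩
      have hxy : x ≠ y := by rintro rfl; omega
      obtain ⟨hne, h⟩ := (symmDiff_eq_pair_iff hAB hxy).1 h
      refine ⟨fun h => hne (congrArg _ h), Or.inl ?_⟩
      rcases hadj with hadj | hadj
      · exact ⟨x, y, hadj, h⟩
      · exact ⟨y, x, hadj, Equiv.swap_comm x y ▸ h⟩

theorem symmDiff_pair_pair {V : Type*} [DecidableEq V] {a b c : V} (hab : a ≠ b) (hac : a ≠ c)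
    (hbc : b ≠ c) : symmDiff ({a, b} : Finset V) {a, c} = {b, c} := by
  ext k
  simp only [Finset.mem_symmDiff, Finset.mem_insert, Finset.mem_singleton]
  grind

/-- The pair of path vertices corresponding to a cell of the triangle. -/
def pairOfCell {n : ℕ} (p : (triangleVertices n : Set (ℤ × ℤ))) :
    {A : Finset (Fin (n + 1)) // A.card = 2} :=
  have h := mem_triangleVertices.1 (Finset.mem_coe.1 p.2)
  ⟨{⟨(p.1.1 - 1).toNat, by omega⟩, ⟨p.1.2.toNat, by omega⟩}, Finset.card_pair (by
    rw [Ne, Fin.mk.injEq]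
    omega)⟩

theorem exists_pairOfCell_eq {n : ℕ} (p : (triangleVertices n : Set (ℤ × ℤ))) :
    ∃ a b : Fin (n + 1), (a : ℤ) = p.1.1 - 1 ∧ (b : ℤ) = p.1.2 ∧ a ≠ b ∧
      (pairOfCell p).1 = {a, b} := by
  have h := mem_triangleVertices.1 (Finset.mem_coe.1 p.2)
  refine ⟨_, _, ?_, ?_, ?_, rfl⟩
  · simp only
    omega
  · simp only
    omega
  · rw [Ne, Fin.mk.injEq]
    omega

theorem pairOfCell_bijective (n : ℕ) : Function.Bijective (pairOfCell (n := n)) := by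
  constructor
  · intro p q h
    obtain ⟨a, b, ha, hb, hab, e⟩ := exists_pairOfCell_eq p
    obtain ⟨a', b', ha', hb', hab', e'⟩ := exists_pairOfCell_eq q
    have hp := mem_triangleVertices.1 (Finset.mem_coe.1 p.2)
    have hq := mem_triangleVertices.1 (Finset.mem_coe.1 q.2)
    rw [h, e'] at e
    have h1 : a ∈ ({a', b'} : Finset _) := by simp [e]
    have h2 : b ∈ ({a', b'} : Finset _) := by simp [e]
    simp only [Finset.mem_insert, Finset.mem_singleton] at h1 h2
    refine Subtype.ext (Prod.ext ?_ ?_) <;>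
      rcases h1 with rfl | rfl <;> rcases h2 with rfl | rfl <;> omega
  · rintro ⟨A, hA⟩
    obtain ⟨x, y, hxy, rfl⟩ := Finset.card_eq_two.1 hA
    wlog hlt : x < y generalizing x y
    · obtain ⟨p, hp⟩ := this y x hxy.symm (Finset.pair_comm x y ▸ hA)
        (lt_of_le_of_ne (not_lt.1 hlt) hxy.symm)
      exact ⟨p, hp.trans (Subtype.ext (Finset.pair_comm y x))⟩
    have hlt' : (x : ℕ) < y := hlt
    refine ⟨⟨((x : ℤ) + 1, y), Finset.mem_coe.2 (mem_triangleVertices.2 ?_)⟩, Subtype.ext ?_⟩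
    · have := y.2
      simp only
      omega
    · simp [pairOfCell]

theorem pair_eq_or_succ {a b a' b' x y : ℕ} (hab : a < b) (hab' : a' < b')
    (hadj : x + 1 = y ∨ y + 1 = x) (hx : x = a ∨ x = b) (hx' : ¬(x = a' ∨ x = b'))
    (hy : y = a' ∨ y = b') (hy' : ¬(y = a ∨ y = b))
    (ha : (a = a' ∨ a = b') ∨ a = x ∨ a = y) (hb : (b = a' ∨ b = b') ∨ b = x ∨ b = y) :
    (a = a' ∧ (b + 1 = b' ∨ b' + 1 = b)) ∨ (b = b' ∧ (a + 1 = a' ∨ a' + 1 = a)) := by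
  rcases hx with rfl | rfl <;> rcases hy with rfl | rfl <;> rcases hadj with h | h <;> omega

theorem pairOfCell_adj {n : ℕ} (p q : (triangleVertices n : Set (ℤ × ℤ))) :
    (tokenGraph 2 (pathGraph (n + 1))).Adj (pairOfCell p) (pairOfCell q) ↔
      (triangleGrid n).Adj p q := by
  obtain ⟨a, b, ha, hb, hab, e⟩ := exists_pairOfCell_eq p
  obtain ⟨a', b', ha', hb', hab', e'⟩ := exists_pairOfCell_eq q
  have hp := mem_triangleVertices.1 (Finset.mem_coe.1 p.2)
  have hq := mem_triangleVertices.1 (Finset.mem_coe.1 q.2)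
  have hcard := (pairOfCell p).2.trans (pairOfCell q).2.symm
  show (∃ x y, (pathGraph (n + 1)).Adj x y ∧ symmDiff (pairOfCell p).1 (pairOfCell q).1 = {x, y}) ↔
    |p.1.1 - q.1.1| + |p.1.2 - q.1.2| = 1
  simp only [pathGraph_adj]
  rw [e, e'] at hcard ⊢
  constructor
  · rintro ⟨x, y, hadj, h⟩
    have hxy : x ≠ y := by rintro rfl; omega
    have hm := mem_of_symmDiff_eq_pair hcard hxy h
    have hk : ∀ k, ((k = a ∨ k = b) ∧ ¬(k = a' ∨ k = b') ∨ (k = a' ∨ k = b') ∧ ¬(k = a ∨ k = b)) ↔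
        k = x ∨ k = y := fun k => by
      simpa [Finset.mem_symmDiff] using Finset.ext_iff.1 h k
    have hka : (a = a' ∨ a = b') ∨ a = x ∨ a = y :=
      or_iff_not_imp_left.2 fun h => (hk a).1 (Or.inl ⟨Or.inl rfl, h⟩)
    have hkb : (b = a' ∨ b = b') ∨ b = x ∨ b = y :=
      or_iff_not_imp_left.2 fun h => (hk b).1 (Or.inl ⟨Or.inr rfl, h⟩)
    simp only [Finset.mem_insert, Finset.mem_singleton] at hm
    clear hk h hcard e e'
    have key : (a = a' ∧ ((b : ℕ) + 1 = b' ∨ (b' : ℕ) + 1 = b)) ∨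
        (b = b' ∧ ((a : ℕ) + 1 = a' ∨ (a' : ℕ) + 1 = a)) := by
      simp only [Fin.ext_iff] at hm hka hkb ⊢
      rcases hm with ⟨h1, h2, h3, h4⟩ | ⟨h1, h2, h3, h4⟩
      · exact pair_eq_or_succ (by omega) (by omega) hadj h1 h2 h3 h4 hka hkb
      · exact pair_eq_or_succ (by omega) (by omega) hadj.symm h1 h2 h3 h4
          (hka.imp_right Or.symm) (hkb.imp_right Or.symm)
    simp only [Fin.ext_iff] at key
    rcases key with ⟨h1, h2 | h2⟩ | ⟨h1, h2 | h2⟩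
    · rw [show p.1.1 - q.1.1 = 0 by omega, show p.1.2 - q.1.2 = -1 by omega]
      rfl
    · rw [show p.1.1 - q.1.1 = 0 by omega, show p.1.2 - q.1.2 = 1 by omega]
      rfl
    · rw [show p.1.1 - q.1.1 = -1 by omega, show p.1.2 - q.1.2 = 0 by omega]
      rfl
    · rw [show p.1.1 - q.1.1 = 1 by omega, show p.1.2 - q.1.2 = 0 by omega]
      rfl
  · intro h
    have h1 : |p.1.1 - q.1.1| + |p.1.2 - q.1.2| < 2 := by omega
    have h0 : ¬|p.1.1 - q.1.1| + |p.1.2 - q.1.2| < 1 := by omega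
    rw [abs_add_abs_lt_iff] at h0 h1
    rcases eq_or_ne a a' with rfl | hne
    · refine ⟨b, b', by omega, symmDiff_pair_pair hab hab' ?_⟩
      rintro rfl
      omega
    · rw [Ne, Fin.ext_iff] at hne
      obtain rfl : b = b' := by
        rw [Fin.ext_iff]
        omega
      refine ⟨a, a', by omega, ?_⟩
      rw [Finset.pair_comm a, Finset.pair_comm a']
      refine symmDiff_pair_pair hab.symm hab'.symm ?_
      rintro rfl
      omega

/-- The two-token graph of a path is a triangle in the grid. -/
noncomputable def tokenGraphIsoTriangleGrid (n : ℕ) :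
    tokenGraph 2 (pathGraph (n + 1)) ≃g triangleGrid n :=
  (RelIso.mk (Equiv.ofBijective _ (pairOfCell_bijective n))
    (fun {p q} => pairOfCell_adj p q) : triangleGrid n ≃g tokenGraph 2 (pathGraph (n + 1))).symm

/-! ### Distances in the triangle -/

/-- Restricting to the triangle could only lengthen paths, but two of its cells at grid distance 2
always have a common neighbour inside it. -/
theorem triangleGrid_three_le_edist_iff {n : ℕ} {p q : (triangleVertices n : Set (ℤ × ℤ))}
    (hne : p ≠ q) :
    3 ≤ (triangleGrid n).edist p q ↔ 3 ≤ |p.1.1 - q.1.1| + |p.1.2 - q.1.2| := by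
  have hadj : ∀ u v : (triangleVertices n : Set (ℤ × ℤ)), (triangleGrid n).Adj u v ↔
      |u.1.1 - v.1.1| + |u.1.2 - v.1.2| = 1 := fun u v => Iff.rfl
  rw [three_le_edist_iff hne]
  simp only [hadj]
  obtain ⟨⟨i, j⟩, hp⟩ := p
  obtain ⟨⟨i', j'⟩, hq⟩ := q
  have hp' := mem_triangleVertices.1 (Finset.mem_coe.1 hp)
  have hq' := mem_triangleVertices.1 (Finset.mem_coe.1 hq)
  rw [Ne, Subtype.mk.injEq, Prod.mk.injEq] at hne
  simp only at hp' hq' ⊢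
  constructor
  · rintro ⟨h1, h2⟩
    by_contra hlt
    rw [not_le] at hlt
    have hlt' := abs_add_abs_lt_iff.1 hlt
    have hone : ∀ a b : ℤ, (a + b < 2 ∧ a - b < 2 ∧ b - a < 2 ∧ -a - b < 2) → (a ≠ 0 ∨ b ≠ 0) →
        |a| + |b| = 1 := by
      intro a b h h0
      have h1 := abs_add_abs_lt_iff.2 h
      have h2 : 0 < |a| ∨ 0 < |b| := h0.imp abs_pos.2 abs_pos.2
      have := abs_nonneg a
      have := abs_nonneg b
      omega
    have hmid : ∀ k l : ℤ, 1 ≤ k → k ≤ l → l ≤ n →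
        ((i - k) + (j - l) < 2 ∧ (i - k) - (j - l) < 2 ∧ (j - l) - (i - k) < 2 ∧
          -(i - k) - (j - l) < 2) → (i - k ≠ 0 ∨ j - l ≠ 0) →
        ((k - i') + (l - j') < 2 ∧ (k - i') - (l - j') < 2 ∧ (l - j') - (k - i') < 2 ∧
          -(k - i') - (l - j') < 2) → (k - i' ≠ 0 ∨ l - j' ≠ 0) → False := by
      intro k l hk hkl hl h3 h4 h5 h6
      exact h2 ⟨(k, l), Finset.mem_coe.2 (mem_triangleVertices.2 ⟨hk, hkl, hl⟩)⟩
        ⟨hone _ _ h3 h4, hone _ _ h5 h6⟩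
    have h1' : ¬((i - i') + (j - j') < 2 ∧ (i - i') - (j - j') < 2 ∧ (j - j') - (i - i') < 2 ∧
          -(i - i') - (j - j') < 2) := fun h => h1 (hone _ _ h (by omega))
    rcases lt_trichotomy i i' with hi | hi | hi <;> rcases lt_trichotomy j j' with hj | hj | hj
    -- For a step that increases both coordinates, the intermediate cell is the one farther from the
    -- diagonal; the other one may leave the triangle.
    · exact hmid i j' (by omega) (by omega) (by omega) (by omega) (by omega) (by omega) (by omega)
    · exact hmid (i + 1) j (by omega) (by omega) (by omega) (by omega) (by omega) (by omega)
        (by omega)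
    · exact hmid (i + 1) j (by omega) (by omega) (by omega) (by omega) (by omega) (by omega)
        (by omega)
    · exact hmid i (j + 1) (by omega) (by omega) (by omega) (by omega) (by omega) (by omega)
        (by omega)
    · exact hne ⟨hi, hj⟩
    · exact hmid i (j - 1) (by omega) (by omega) (by omega) (by omega) (by omega) (by omega)
        (by omega)
    · exact hmid i j' (by omega) (by omega) (by omega) (by omega) (by omega) (by omega) (by omega)
    · exact hmid (i - 1) j (by omega) (by omega) (by omega) (by omega) (by omega) (by omega)
        (by omega)
    · exact hmid i' j (by omega) (by omega) (by omega) (by omega) (by omega) (by omega) (by omega)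
  · intro h
    refine ⟨fun h1 => by omega, fun ⟨⟨k, l⟩, _⟩ ⟨h1, h2⟩ => ?_⟩
    simp only at h1 h2
    have e1 := abs_sub_le i k i'
    have e2 := abs_sub_le j l j'
    omega

theorem packingNumber_triangleGrid_eq {n k : ℕ} (hle : ∀ S, IsTrianglePacking n S → S.card ≤ k)
    (hex : ∃ S, IsTrianglePacking n S ∧ S.card = k) : packingNumber (triangleGrid n) = k := by
  apply IsGreatest.csSup_eq
  constructor
  · obtain ⟨S, hS, rfl⟩ := hex
    refine ⟨S.subtype fun p => p ∈ (triangleVertices n : Set (ℤ × ℤ)), ?_, ?_⟩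
    · intro u hu v hv hne
      rw [Finset.mem_coe, Finset.mem_subtype] at hu hv
      exact (triangleGrid_three_le_edist_iff hne).2
        (hS.dist _ hu _ hv fun h => hne (Subtype.ext h))
    · rw [Finset.card_subtype, Finset.filter_true_of_mem fun p hp => Finset.mem_coe.2 (hS.subset hp)]
  · rintro _ ⟨S, hS, rfl⟩
    rw [← Finset.card_map (Function.Embedding.subtype _)]
    apply hle
    constructor
    · intro p hp
      obtain ⟨p, _, rfl⟩ := Finset.mem_map.1 hp
      exact Finset.mem_coe.1 p.2
    · intro u hu v hv hne
      obtain ⟨u', hu', rfl⟩ := Finset.mem_map.1 hu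
      obtain ⟨v', hv', rfl⟩ := Finset.mem_map.1 hv
      have hne' : u' ≠ v' := fun h => hne (congrArg _ h)
      exact (triangleGrid_three_le_edist_iff hne').1 (hS u' hu' v' hv' hne')

/-! ### Lattice codes and the lower bound -/

/-- The part of a perfect code of the grid that lies in the triangle. -/
noncomputable def latticeCode (c : ℤ) (n : ℕ) : Finset (ℤ × ℤ) :=
  (triangleVertices n).filter fun p => (p.1 + 2 * p.2) % 5 = c

theorem mem_latticeCode {c : ℤ} {n : ℕ} {p : ℤ × ℤ} :
    p ∈ latticeCode c n ↔ (1 ≤ p.1 ∧ p.1 ≤ p.2 ∧ p.2 ≤ n) ∧ (p.1 + 2 * p.2) % 5 = c := by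
  rw [latticeCode, Finset.mem_filter, mem_triangleVertices]

theorem card_filter_range_mod_five {c : ℤ} (h0 : 0 ≤ c) (h5 : c < 5) (w : ℤ) (k : ℕ) :
    (((Finset.range k).filter fun i : ℕ => ((i : ℤ) + 1 + w) % 5 = c).card : ℤ) =
      (k + 4 - (c - w - 1) % 5) / 5 := by
  induction k with
  | zero => simp; omega
  | succ k ih =>
    rw [Finset.range_add_one, Finset.filter_insert]
    split_ifs with h
    · rw [Finset.card_insert_of_notMem (by simp)]
      push_cast
      omega
    · push_cast
      omega

theorem card_latticeCode {c : ℤ} (h0 : 0 ≤ c) (h5 : c < 5) (n : ℕ) :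
    ((latticeCode c n).card : ℤ) =
      ∑ j ∈ Finset.range (n + 1), ((j : ℤ) + 4 - (c - 2 * j - 1) % 5) / 5 := by
  rw [Finset.card_eq_sum_card_fiberwise (f := fun p : ℤ × ℤ => p.2.toNat)
    (t := Finset.range (n + 1))]
  · push_cast
    refine Finset.sum_congr rfl fun j hj => ?_
    rw [← card_filter_range_mod_five h0 h5, Nat.cast_inj]
    symm
    rw [Finset.mem_range] at hj
    refine Finset.card_bij (fun i _ => ((i : ℤ) + 1, (j : ℤ))) ?_ ?_ ?_
    · intro i hi
      rw [Finset.mem_filter, Finset.mem_range] at hi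
      rw [Finset.mem_filter, mem_latticeCode]
      simp only
      exact ⟨⟨by omega, hi.2⟩, by omega⟩
    · intro i _ i' _ h
      rw [Prod.mk.injEq] at h
      omega
    · rintro ⟨a, b⟩ hp
      rw [Finset.mem_filter, mem_latticeCode] at hp
      simp only at hp
      refine ⟨(a - 1).toNat, ?_, ?_⟩
      · rw [Finset.mem_filter, Finset.mem_range]
        omega
      · rw [Prod.mk.injEq]
        omega
  · intro p hp
    rw [Finset.mem_coe, mem_latticeCode] at hp
    rw [Finset.mem_coe, Finset.mem_range]
    show p.2.toNat < n + 1
    omega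

/-- Five consecutive rows run through all residues modulo 5, so their rounding errors have a
constant total. It follows that 10|L| − n² − n depends only on c and n modulo 5. -/
theorem card_latticeCode_add_five {c : ℤ} (h0 : 0 ≤ c) (h5 : c < 5) (n : ℕ) :
    (latticeCode c (n + 5)).card = (latticeCode c n).card + n + 3 := by
  zify
  rw [card_latticeCode h0 h5, card_latticeCode h0 h5]
  simp only [show n + 5 + 1 = n + 1 + 1 + 1 + 1 + 1 + 1 from rfl, Finset.sum_range_succ _ (n + 1),
    Finset.sum_range_succ _ (n + 1 + 1), Finset.sum_range_succ _ (n + 1 + 1 + 1),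
    Finset.sum_range_succ _ (n + 1 + 1 + 1 + 1), Finset.sum_range_succ _ (n + 1 + 1 + 1 + 1 + 1)]
  push_cast
  generalize ∑ j ∈ Finset.range (n + 1), ((j : ℤ) + 4 - (c - 2 * j - 1) % 5) / 5 = t
  obtain ⟨q, r, hr0, hr5, hn⟩ : ∃ q r : ℤ, 0 ≤ r ∧ r < 5 ∧ (n : ℤ) = 5 * q + r :=
    ⟨n / 5, n % 5, by omega, by omega, by omega⟩
  have key : ∀ x y : ℤ, x = 5 * q + y →
      (x + 4 - (c - 2 * x - 1) % 5) / 5 = q + (y + 4 - (c - 2 * y - 1) % 5) / 5 := by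
    rintro x y rfl
    rw [show c - 2 * (5 * q + y) - 1 = c - 2 * y - 1 + 5 * (-2 * q) by ring,
      Int.add_mul_emod_self_left]
    omega
  rw [key (n + 1) (r + 1) (by omega), key (n + 1 + 1) (r + 2) (by omega),
    key (n + 1 + 1 + 1) (r + 3) (by omega), key (n + 1 + 1 + 1 + 1) (r + 4) (by omega),
    key (n + 1 + 1 + 1 + 1 + 1) (r + 5) (by omega), hn]
  clear key hn
  interval_cases c <;> interval_cases r <;> norm_num <;> ring

/-- Exchanging a few vertices of a lattice code. -/
theorem exists_packing_of_exchange {c : ℤ} {n : ℕ} {A R : Finset (ℤ × ℤ)}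
    (hA : ∀ p ∈ A, p ∈ triangleVertices n ∧ (p.1 + 2 * p.2) % 5 ≠ c)
    (hAA : ∀ p ∈ A, ∀ q ∈ A, p ≠ q → ¬|p.1 - q.1| + |p.2 - q.2| < 3)
    (hAL : ∀ p ∈ A, ∀ q ∈ latticeCode c n, |p.1 - q.1| + |p.2 - q.2| < 3 → q ∈ R) :
    ∃ S, IsTrianglePacking n S ∧ (latticeCode c n).card + A.card ≤ S.card + R.card := by
  refine ⟨(latticeCode c n \ R) ∪ A, ⟨?_, ?_⟩, ?_⟩
  · intro p hp
    rcases Finset.mem_union.1 hp with hp | hp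
    · exact (Finset.mem_filter.1 (Finset.mem_sdiff.1 hp).1).1
    · exact (hA p hp).1
  · intro p hp q hq hne
    rw [← not_lt]
    intro hlt
    rcases Finset.mem_union.1 hp with hp | hp <;> rcases Finset.mem_union.1 hq with hq | hq
    · have h1 := mem_latticeCode.1 (Finset.mem_sdiff.1 hp).1
      have h2 := mem_latticeCode.1 (Finset.mem_sdiff.1 hq).1
      rw [abs_add_abs_lt_iff] at hlt
      apply hne
      -- At distance below 3 the form i + 2j changes by less than 5, so congruence forces equality.
      -- The difference is then a multiple of (−2, 1), which has length 3.
      have h3 : p.1 + 2 * p.2 = q.1 + 2 * q.2 := by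
        have : (p.1 + 2 * p.2 - (q.1 + 2 * q.2)) % 5 = 0 := by omega
        have : p.1 + 2 * p.2 - (q.1 + 2 * q.2) < 5 := by omega
        have : -5 < p.1 + 2 * p.2 - (q.1 + 2 * q.2) := by omega
        omega
      rw [Prod.ext_iff]
      constructor <;> omega
    · rw [abs_sub_comm p.1, abs_sub_comm p.2] at hlt
      exact (Finset.mem_sdiff.1 hp).2 (hAL q hq p (Finset.mem_sdiff.1 hp).1 hlt)
    · exact (Finset.mem_sdiff.1 hq).2 (hAL p hp q (Finset.mem_sdiff.1 hq).1 hlt)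
    · exact hAA p hp q hq hne hlt
  · rw [Finset.card_union_of_disjoint]
    · have := Finset.le_card_sdiff R (latticeCode c n)
      omega
    · rw [Finset.disjoint_left]
      intro p hp hp'
      exact (hA p hp').2 (mem_latticeCode.1 (Finset.mem_sdiff.1 hp).1).2

theorem ten_mul_card_latticeCode {c : ℤ} (h0 : 0 ≤ c) (h5 : c < 5) {r : ℕ} {e : ℤ}
    (hr : 10 * ((latticeCode c r).card : ℤ) = (r : ℤ) ^ 2 + r + e) (q : ℕ) :
    10 * ((latticeCode c (5 * q + r)).card : ℤ) =
      ((5 * q + r : ℕ) : ℤ) ^ 2 + (5 * q + r : ℕ) + e := by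
  induction q with
  | zero => simpa using hr
  | succ q ih =>
    rw [show 5 * (q + 1) + r = 5 * q + r + 5 by ring, card_latticeCode_add_five h0 h5]
    push_cast at ih ⊢
    linear_combination ih

theorem ten_mul_card_latticeCode_of_mod {c : ℤ} (h0 : 0 ≤ c) (h5 : c < 5) {n r : ℕ} {e : ℤ}
    (hn : n % 5 = r)
    (hr : 10 * ∑ j ∈ Finset.range (r + 1), ((j : ℤ) + 4 - (c - 2 * j - 1) % 5) / 5 =
      (r : ℤ) ^ 2 + r + e) :
    10 * ((latticeCode c n).card : ℤ) = (n : ℤ) ^ 2 + n + e := by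
  have := ten_mul_card_latticeCode h0 h5 (r := r) (e := e)
    (by rw [card_latticeCode h0 h5, hr]) (n / 5)
  rwa [← hn, Nat.div_add_mod] at this

/-- The lattice code has (n² + n)/10 cells, two short. Near (1, 1) three cells replace two, and near
(n, n) four replace three. -/
theorem exists_packing_of_mod_eq_zero {n : ℕ} (hn : 6 ≤ n) (h : n % 5 = 0) :
    ∃ S, IsTrianglePacking n S ∧ (n ^ 2 + n) / 10 + 2 ≤ S.card := by
  obtain ⟨S, hS, hcard⟩ := exists_packing_of_exchange (c := 2) (n := n)
    (A := {(1, 1), (1, 5), (2, 3), ((n : ℤ) - 4, (n : ℤ)), ((n : ℤ) - 3, (n : ℤ) - 3), ((n : ℤ) - 2, (n : ℤ) - 1), ((n : ℤ), (n : ℤ))})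
    (R := {(1, 3), (2, 5), ((n : ℤ) - 4, (n : ℤ) - 2), ((n : ℤ) - 3, (n : ℤ)), ((n : ℤ) - 1, (n : ℤ) - 1)})
    (by
      intro p hp
      simp only [Finset.mem_insert, Finset.mem_singleton, Prod.ext_iff] at hp
      rw [mem_triangleVertices]
      omega)
    (by
      intro p hp q hq hne
      simp only [Finset.mem_insert, Finset.mem_singleton, Prod.ext_iff] at hp hq
      rw [ne_eq, Prod.ext_iff] at hne
      rw [abs_add_abs_lt_iff]
      rcases hp with h | h | h | h | h | h | h <;> omega)
    (by
      intro p hp q hq hlt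
      simp only [Finset.mem_insert, Finset.mem_singleton, Prod.ext_iff] at hp ⊢
      rw [mem_latticeCode] at hq
      rw [abs_add_abs_lt_iff] at hlt
      have h2 : q.2 = p.2 - 2 ∨ q.2 = p.2 - 1 ∨ q.2 = p.2 ∨ q.2 = p.2 + 1 ∨ q.2 = p.2 + 2 := by
        omega
      rcases hp with h | h | h | h | h | h | h <;> rcases h2 with h2 | h2 | h2 | h2 | h2 <;> omega)
  refine ⟨S, hS, ?_⟩
  rw [Finset.card_insert_of_notMem, Finset.card_insert_of_notMem, Finset.card_insert_of_notMem,
    Finset.card_insert_of_notMem, Finset.card_insert_of_notMem, Finset.card_insert_of_notMem,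
    Finset.card_singleton] at hcard
  · have hc := ten_mul_card_latticeCode_of_mod (c := 2) (e := 0) (by norm_num) (by norm_num) h
      (by decide)
    have hR := hcard.trans (Nat.add_le_add_left Finset.card_le_five _)
    zify at hR ⊢
    omega
  all_goals
    simp only [Finset.mem_insert, Finset.mem_singleton, Prod.mk.injEq]
    omega

/-- Both acute corners are at distance at least 3 from this lattice code and can simply be added. -/
theorem exists_packing_of_mod_eq_one {n : ℕ} (hn : 6 ≤ n) (h : n % 5 = 1) :
    ∃ S, IsTrianglePacking n S ∧ (n ^ 2 + n) / 10 + 2 ≤ S.card := by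
  obtain ⟨S, hS, hcard⟩ := exists_packing_of_exchange (c := 4) (n := n)
    (A := {(1, 1), ((n : ℤ), (n : ℤ))})
    (R := ∅)
    (by
      intro p hp
      simp only [Finset.mem_insert, Finset.mem_singleton, Prod.ext_iff] at hp
      rw [mem_triangleVertices]
      omega)
    (by
      intro p hp q hq hne
      simp only [Finset.mem_insert, Finset.mem_singleton, Prod.ext_iff] at hp hq
      rw [ne_eq, Prod.ext_iff] at hne
      rw [abs_add_abs_lt_iff]
      rcases hp with h | h <;> omega)
    (by
      intro p hp q hq hlt
      simp only [Finset.mem_insert, Finset.mem_singleton, Prod.ext_iff] at hp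
      rw [mem_latticeCode] at hq
      rw [abs_add_abs_lt_iff] at hlt
      exfalso
      have h2 : q.2 = p.2 - 2 ∨ q.2 = p.2 - 1 ∨ q.2 = p.2 ∨ q.2 = p.2 + 1 ∨ q.2 = p.2 + 2 := by
        omega
      rcases hp with h | h <;> rcases h2 with h2 | h2 | h2 | h2 | h2 <;> omega)
  refine ⟨S, hS, ?_⟩
  rw [Finset.card_insert_of_notMem, Finset.card_singleton] at hcard
  · have hc := ten_mul_card_latticeCode_of_mod (c := 4) (e := -2) (by norm_num) (by norm_num) h
      (by decide)
    rw [Finset.card_empty] at hcard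
    zify at hcard ⊢
    omega
  all_goals
    simp only [Finset.mem_singleton, Prod.mk.injEq]
    omega

/-- Here the lattice code has (n² + n + 4)/10 cells, one short, so an exchange at a single corner is
enough. -/
theorem exists_packing_of_mod_eq_two {n : ℕ} (hn : 6 ≤ n) (h : n % 5 = 2) :
    ∃ S, IsTrianglePacking n S ∧ (n ^ 2 + n) / 10 + 2 ≤ S.card := by
  obtain ⟨S, hS, hcard⟩ := exists_packing_of_exchange (c := 0) (n := n)
    (A := {(1, 1), (1, 4), (3, 3)})
    (R := {(1, 2), (2, 4)})
    (by
      intro p hp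
      simp only [Finset.mem_insert, Finset.mem_singleton, Prod.ext_iff] at hp
      rw [mem_triangleVertices]
      omega)
    (by
      intro p hp q hq hne
      simp only [Finset.mem_insert, Finset.mem_singleton, Prod.ext_iff] at hp hq
      rw [ne_eq, Prod.ext_iff] at hne
      rw [abs_add_abs_lt_iff]
      rcases hp with h | h | h <;> omega)
    (by
      intro p hp q hq hlt
      simp only [Finset.mem_insert, Finset.mem_singleton, Prod.ext_iff] at hp ⊢
      rw [mem_latticeCode] at hq
      rw [abs_add_abs_lt_iff] at hlt
      have h2 : q.2 = p.2 - 2 ∨ q.2 = p.2 - 1 ∨ q.2 = p.2 ∨ q.2 = p.2 + 1 ∨ q.2 = p.2 + 2 := by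
        omega
      rcases hp with h | h | h <;> rcases h2 with h2 | h2 | h2 | h2 | h2 <;> omega)
  refine ⟨S, hS, ?_⟩
  rw [Finset.card_insert_of_notMem, Finset.card_insert_of_notMem, Finset.card_singleton] at hcard
  · have hc := ten_mul_card_latticeCode_of_mod (c := 0) (e := 4) (by norm_num) (by norm_num) h
      (by decide)
    have hR := hcard.trans (Nat.add_le_add_left Finset.card_le_two _)
    zify at hR ⊢
    omega
  all_goals
    simp only [Finset.mem_insert, Finset.mem_singleton, Prod.mk.injEq]
    omega

/-- The exchange at (1, 1) gains one codeword, and (n, n) is free to be added. -/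
theorem exists_packing_of_mod_eq_three {n : ℕ} (hn : 6 ≤ n) (h : n % 5 = 3) :
    ∃ S, IsTrianglePacking n S ∧ (n ^ 2 + n) / 10 + 2 ≤ S.card := by
  obtain ⟨S, hS, hcard⟩ := exists_packing_of_exchange (c := 0) (n := n)
    (A := {(1, 1), (1, 4), (3, 3), ((n : ℤ), (n : ℤ))})
    (R := {(1, 2), (2, 4)})
    (by
      intro p hp
      simp only [Finset.mem_insert, Finset.mem_singleton, Prod.ext_iff] at hp
      rw [mem_triangleVertices]
      omega)
    (by
      intro p hp q hq hne
      simp only [Finset.mem_insert, Finset.mem_singleton, Prod.ext_iff] at hp hq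
      rw [ne_eq, Prod.ext_iff] at hne
      rw [abs_add_abs_lt_iff]
      rcases hp with h | h | h | h <;> omega)
    (by
      intro p hp q hq hlt
      simp only [Finset.mem_insert, Finset.mem_singleton, Prod.ext_iff] at hp ⊢
      rw [mem_latticeCode] at hq
      rw [abs_add_abs_lt_iff] at hlt
      have h2 : q.2 = p.2 - 2 ∨ q.2 = p.2 - 1 ∨ q.2 = p.2 ∨ q.2 = p.2 + 1 ∨ q.2 = p.2 + 2 := by
        omega
      rcases hp with h | h | h | h <;> rcases h2 with h2 | h2 | h2 | h2 | h2 <;> omega)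
  refine ⟨S, hS, ?_⟩
  rw [Finset.card_insert_of_notMem, Finset.card_insert_of_notMem, Finset.card_insert_of_notMem,
    Finset.card_singleton] at hcard
  · have hc := ten_mul_card_latticeCode_of_mod (c := 0) (e := -2) (by norm_num) (by norm_num) h
      (by decide)
    have hR := hcard.trans (Nat.add_le_add_left Finset.card_le_two _)
    zify at hR ⊢
    omega
  all_goals
    simp only [Finset.mem_insert, Finset.mem_singleton, Prod.mk.injEq]
    omega

/-- At each acute corner three cells replace two. -/
theorem exists_packing_of_mod_eq_four {n : ℕ} (hn : 6 ≤ n) (h : n % 5 = 4) :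
    ∃ S, IsTrianglePacking n S ∧ (n ^ 2 + n) / 10 + 2 ≤ S.card := by
  obtain ⟨S, hS, hcard⟩ := exists_packing_of_exchange (c := 0) (n := n)
    (A := {(1, 1), (1, 4), (3, 3), ((n : ℤ) - 3, (n : ℤ)), ((n : ℤ) - 2, (n : ℤ) - 2), ((n : ℤ), (n : ℤ))})
    (R := {(1, 2), (2, 4), ((n : ℤ) - 3, (n : ℤ) - 2), ((n : ℤ) - 2, (n : ℤ))})
    (by
      intro p hp
      simp only [Finset.mem_insert, Finset.mem_singleton, Prod.ext_iff] at hp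
      rw [mem_triangleVertices]
      omega)
    (by
      intro p hp q hq hne
      simp only [Finset.mem_insert, Finset.mem_singleton, Prod.ext_iff] at hp hq
      rw [ne_eq, Prod.ext_iff] at hne
      rw [abs_add_abs_lt_iff]
      rcases hp with h | h | h | h | h | h <;> omega)
    (by
      intro p hp q hq hlt
      simp only [Finset.mem_insert, Finset.mem_singleton, Prod.ext_iff] at hp ⊢
      rw [mem_latticeCode] at hq
      rw [abs_add_abs_lt_iff] at hlt
      have h2 : q.2 = p.2 - 2 ∨ q.2 = p.2 - 1 ∨ q.2 = p.2 ∨ q.2 = p.2 + 1 ∨ q.2 = p.2 + 2 := by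
        omega
      rcases hp with h | h | h | h | h | h <;> rcases h2 with h2 | h2 | h2 | h2 | h2 <;> omega)
  refine ⟨S, hS, ?_⟩
  rw [Finset.card_insert_of_notMem, Finset.card_insert_of_notMem, Finset.card_insert_of_notMem,
    Finset.card_insert_of_notMem, Finset.card_insert_of_notMem, Finset.card_singleton] at hcard
  · have hc := ten_mul_card_latticeCode_of_mod (c := 0) (e := 0) (by norm_num) (by norm_num) h
      (by decide)
    have hR := hcard.trans (Nat.add_le_add_left Finset.card_le_four _)
    zify at hR ⊢
    omega
  all_goals
    simp only [Finset.mem_insert, Finset.mem_singleton, Prod.mk.injEq]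
    omega

theorem exists_packing {n : ℕ} (hn : 6 ≤ n) :
    ∃ S, IsTrianglePacking n S ∧ S.card = (n ^ 2 + n) / 10 + 2 := by
  have hmod : n % 5 = 0 ∨ n % 5 = 1 ∨ n % 5 = 2 ∨ n % 5 = 3 ∨ n % 5 = 4 := by omega
  obtain ⟨S, hS, hcard⟩ : ∃ S, IsTrianglePacking n S ∧ (n ^ 2 + n) / 10 + 2 ≤ S.card := by
    rcases hmod with h | h | h | h | h
    · exact exists_packing_of_mod_eq_zero hn h
    · exact exists_packing_of_mod_eq_one hn h
    · exact exists_packing_of_mod_eq_two hn h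
    · exact exists_packing_of_mod_eq_three hn h
    · exact exists_packing_of_mod_eq_four hn h
  exact ⟨S, hS, le_antisymm (hS.card_le hn) hcard⟩

theorem packingNumber_triangleGrid {n : ℕ} (hn : 6 ≤ n) :
    packingNumber (triangleGrid n) = (n ^ 2 + n) / 10 + 2 :=
  packingNumber_triangleGrid_eq (fun _ hS => hS.card_le hn) (exists_packing hn)

theorem cast_div_add_two_eq_aSeq (n : ℕ) : (((n ^ 2 + n) / 10 + 2 : ℕ) : ℚ) = aSeq n := by
  have key {d : ℕ} (hd : (n ^ 2 + n) % 10 = d) :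
      (((n ^ 2 + n) / 10 + 2 : ℕ) : ℚ) = ((n : ℚ) ^ 2 + n + (20 - d)) / 10 := by
    have h : ((10 * ((n ^ 2 + n) / 10) + (n ^ 2 + n) % 10 : ℕ) : ℚ) = (n ^ 2 + n : ℕ) := by
      rw [Nat.div_add_mod]
    rw [hd] at h
    generalize (n ^ 2 + n) / 10 = t at h ⊢
    push_cast at h ⊢
    linear_combination h / 10
  have hmod : (n ^ 2 + n) % 10 = ((n % 10) ^ 2 + n % 10) % 10 := by
    rw [Nat.add_mod, Nat.pow_mod, Nat.add_mod ((n % 10) ^ 2), Nat.mod_mod]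
  have h5 : n % 5 = n % 10 % 5 := by omega
  have hlt : n % 10 < 10 := Nat.mod_lt _ (by norm_num)
  rw [aSeq, h5]
  generalize n % 10 = r at *
  interval_cases r <;> rw [key hmod] <;> norm_num

end TokenPacking

open TokenPacking in
theorem theorem1 :
    (∀ n : ℕ, 6 ≤ n → (A085680 (n + 1) : ℚ) = aSeq n) ∧
    (∀ n : ℕ, 1 ≤ n →
      A085680 (n + 1) = packingNumber (tokenGraph 2 (SimpleGraph.pathGraph (n + 1))) ∧
      Nonempty (tokenGraph 2 (SimpleGraph.pathGraph (n + 1)) ≃g sloaneGraph (n + 1)) ∧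
      Nonempty (tokenGraph 2 (SimpleGraph.pathGraph (n + 1)) ≃g triangleGrid n)) := by
  have hA (n : ℕ) : A085680 (n + 1) =
      packingNumber (tokenGraph 2 (SimpleGraph.pathGraph (n + 1))) := by
    rw [A085680_eq_packingNumber, packingNumber_congr (tokenGraphIsoSloaneGraph (n + 1))]
  refine ⟨fun n hn => ?_, fun n _ =>
    ⟨hA n, ⟨tokenGraphIsoSloaneGraph (n + 1)⟩, ⟨tokenGraphIsoTriangleGrid n⟩⟩⟩
  rw [hA, packingNumber_congr (tokenGraphIsoTriangleGrid n), packingNumber_triangleGrid hn,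
    cast_div_add_two_eq_aSeq]
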